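/- Let $n\ge 1$ processors $p_0,\dots,p_{n-1}$ form a unidirectional ring (indices modulo $n$), and let $\phi>2n$ and $K>2n$ be integers. Each $p_i$ owns two safe registers $R_a,R_b$ with values in $\{0,\dots,K-1\}$, which are written by $p_i$ only and read by $p_i$ and $p_{i+1}$. Every register operation has an invocation and a later response. A read that is concurrent with no write to the same register returns the register's content (the value most recently written, or the initial content if there was no write); a read concurrent with a write may return any value in $\{0,\dots,K-1\}$. Each $p_i$ repeats the following round forever. 1. Read its own $R_a$ into $x$. 2. $y\leftarrow\mathrm{ARead}(\phi)$, which reads first $R_a$ and then $R_b$ of $p_{i-1}$, $\phi$ times in succession, and returns the common value if all $2\phi$ values read are equal, and $\perp$ otherwise. 3. If $y\ne\perp$, $i\neq 0$ and $x\ne y$, set $x\leftarrow y$ and execute the critical section; else if $y\neq\perp$, $i=0$ and $y=x$, set $x\leftarrow (x+1)\bmod K$ and execute the critical section. 4. $\mathrm{AWrite}(x)$, which reads its own $R_a$ and $R_b$ and returns if both contain $x$; otherwise it writes $x$ to $R_a$, then $x$ to $R_b$, and returns. An execution is an infinite asynchronous interleaving of steps (invocations and responses of register operations, and local steps, where leaving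 the critical section is also a step) in which every processor takes infinitely many steps. The initial configuration (program counters, local variables, register contents, pending operations) is arbitrary. **Theorem.** This protocol is self-stabilizing to mutual exclusion: there is a set $L$ of legitimate configurations such that - $L$ is closed under steps; - every execution, from any initial configuration, reaches $L$; - in every execution starting in $L$, at most one processor is in its critical section at any time, every processor is in its critical section infinitely often, and the right to enter it advances around the ring: the next visit to the critical section after a visit of $p_i$ is one of $p_{i+1}$. -/

import Mathlib

namespace TokenRing

/-- The two safe registers `R_a`, `R_b` that each processor owns. -/
inductive Side where
  | a
  | b
  deriving DecidableEq

/-- Names of registers: `(i, r)` is the output register `R_r` of processor `p_i`.  It is written by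
`p_i` only, and read by `p_i` and by the successor of `p_i` in the ring. -/
abbrev RegName (n : ℕ) : Type := Fin n × Side

/-- The predecessor `i ⊖ 1` in the ring. -/
def prev {n : ℕ} (i : Fin n) : Fin n := ⟨(i.val + n - 1) % n, Nat.mod_lt _ i.pos⟩

/-- The successor `i ⊕ 1` in the ring. -/
def next {n : ℕ} (i : Fin n) : Fin n := ⟨(i.val + 1) % n, Nat.mod_lt _ i.pos⟩

/-- `(x + 1) mod K`. -/
def incMod {K : ℕ} (x : Fin K) : Fin K := ⟨(x.val + 1) % K, Nat.mod_lt _ x.pos⟩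

/-- Program counter. One round of the endless loop of a processor is:
```
readOwn        x ← own R_a
scan j r       ARead(φ): for j = 0, …, φ-1, read R_a of the predecessor into A[j],
               then read R_b of the predecessor into B[j]
areadReturn    y ← the common value of all of A[..], B[..], or ⊥ if they are not all equal
test           if y ≠ ⊥ ∧ i ≠ 0 ∧ x ≠ y then x ← y; critical section
               else if y ≠ ⊥ ∧ i = 0 ∧ y = x then x ← (x + 1) mod K; critical section
crit           (inside the critical section)
awRead r       AWrite(x): read own R_a into wA, then own R_b into wB
awTest         if wA = wB = x then return (the loop starts again)
awWrite r      else write x to own R_a, then x to own R_b, and return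
```
-/
inductive Pc (φ : ℕ) where
  | readOwn
  | scan (j : Fin φ) (r : Side)
  | areadReturn
  | test
  | crit
  | awRead (r : Side)
  | awTest
  | awWrite (r : Side)

/-- Status of the register operation at which the program counter stands.
* `ready`: not yet invoked;
* `active`: invoked, no response yet; for a read: so far not concurrent with any write to the
  register being read;
* `disturbed`: invoked, no response yet; for a read: some write to the register being read has
  been concurrent with it. -/
inductive Phase where
  | ready
  | active
  | disturbed
  deriving DecidableEq

/-- Local state of a processor. `y = none` stands for `⊥`; `A`, `B` are the local arrays of
`ARead(φ)`, and `wA`, `wB` the local variables of `AWrite`. -/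
structure Proc (φ K : ℕ) where
  pc : Pc φ
  phase : Phase
  x : Fin K
  y : Option (Fin K)
  A : Fin φ → Fin K
  B : Fin φ → Fin K
  wA : Fin K
  wB : Fin K

/-- A configuration (global state) of the ring: the local states and the register contents. -/
structure Config (n φ K : ℕ) where
  proc : Fin n → Proc φ K
  reg : RegName n → Fin K

variable {n φ K : ℕ}

/-- The register that `p_i` reads at a program counter (`none` if this is no read operation). -/
def readTarget (i : Fin n) : Pc φ → Option (RegName n)
  | .readOwn => some (i, .a)
  | .scan _ r => some (prev i, r)
  | .awRead r => some (i, r)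
  | _ => none

/-- The register that `p_i` writes at a program counter (`none` if this is no write operation). -/
def writeTarget (i : Fin n) : Pc φ → Option (RegName n)
  | .awWrite r => some (i, r)
  | _ => none

/-- Program counters of steps that are local computations (no register operation). -/
def Pc.IsLocal : Pc φ → Prop
  | .areadReturn | .test | .crit | .awTest => True
  | _ => False

/-- Some processor is in the middle of a write to register `ρ`. -/
def BeingWritten (c : Config n φ K) (ρ : RegName n) : Prop :=
  ∃ j, writeTarget j (c.proc j).pc = some ρ ∧ (c.proc j).phase ≠ .ready

/-- Where the scan loop of `ARead(φ)` continues when `m` iterations are done. -/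
def scanFrom (φ m : ℕ) : Pc φ :=
  if h : m < φ then .scan ⟨m, h⟩ .a else .areadReturn

/-- The response of `ARead(φ)`: `A[first]` if all entries of both arrays agree, and `⊥` if not. -/
def scanResult (A B : Fin φ → Fin K) : Option (Fin K) :=
  if h : 0 < φ then
    if ∀ j, A j = A ⟨0, h⟩ ∧ B j = A ⟨0, h⟩ then some (A ⟨0, h⟩) else none
  else none

/-- A read operation responds with `v`: the value is stored and the program counter advances. -/
def afterRead (s : Proc φ K) (v : Fin K) : Proc φ K :=
  match s.pc with
  | .readOwn => { s with x := v, pc := scanFrom φ 0, phase := .ready }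
  | .scan j .a => { s with A := Function.update s.A j v, pc := .scan j .b, phase := .ready }
  | .scan j .b =>
      { s with B := Function.update s.B j v, pc := scanFrom φ (j.val + 1), phase := .ready }
  | .awRead .a => { s with wA := v, pc := .awRead .b, phase := .ready }
  | .awRead .b => { s with wB := v, pc := .awTest, phase := .ready }
  | _ => s

/-- A write operation responds: the program counter advances. -/
def afterWrite (s : Proc φ K) : Proc φ K :=
  match s.pc with
  | .awWrite .a => { s with pc := .awWrite .b, phase := .ready }
  | .awWrite .b => { s with pc := .readOwn, phase := .ready }
  | _ => s

/-- The test after `ARead(φ)`; processor `p_0` has its own rule. -/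
def afterTest (i : Fin n) (s : Proc φ K) : Proc φ K :=
  match s.y with
  | none => { s with pc := .awRead .a, phase := .ready }
  | some y =>
      if i.val ≠ 0 ∧ s.x ≠ y then { s with x := y, pc := .crit, phase := .ready }
      else if i.val = 0 ∧ y = s.x then { s with x := incMod s.x, pc := .crit, phase := .ready }
      else { s with pc := .awRead .a, phase := .ready }

/-- Effect of a local step of `p_i`. -/
def afterLocal (i : Fin n) (s : Proc φ K) : Proc φ K :=
  match s.pc with
  | .areadReturn => { s with y := scanResult s.A s.B, pc := .test, phase := .ready }
  | .test => afterTest i s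
  | .crit => { s with pc := .awRead .a, phase := .ready }
  | .awTest =>
      if s.wA = s.x ∧ s.wB = s.x then { s with pc := .readOwn, phase := .ready }
      else { s with pc := .awWrite .a, phase := .ready }
  | _ => s

/-- Replace the local state of `p_i`. -/
def Config.setProc (c : Config n φ K) (i : Fin n) (s : Proc φ K) : Config n φ K :=
  { c with proc := Function.update c.proc i s }

/-- A write to `ρ` is being invoked: every pending read of `ρ` is now concurrent with a write. -/
def Config.disturb (c : Config n φ K) (ρ : RegName n) : Config n φ K :=
  { c with proc := fun j =>
      if readTarget j (c.proc j).pc = some ρ ∧ (c.proc j).phase ≠ .ready then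
        { c.proc j with phase := .disturbed }
      else c.proc j }

/-- One step of `p_i`: the invocation or the response of a register operation, or a local step.
The read rules express that registers are safe: a read that is not concurrent with any write to
the register responds with the content of the register, any other read with an arbitrary value
of the domain. -/
inductive Step (i : Fin n) : Config n φ K → Config n φ K → Prop where
  | invokeRead (c : Config n φ K) (ρ : RegName n) (hready : (c.proc i).phase = .ready)
      (hread : readTarget i (c.proc i).pc = some ρ) (hquiet : ¬ BeingWritten c ρ) :
      Step i c (c.setProc i { c.proc i with phase := .active })
  | invokeReadDisturbed (c : Config n φ K) (ρ : RegName n) (hready : (c.proc i).phase = .ready)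
      (hread : readTarget i (c.proc i).pc = some ρ) (hbusy : BeingWritten c ρ) :
      Step i c (c.setProc i { c.proc i with phase := .disturbed })
  | respondRead (c : Config n φ K) (ρ : RegName n) (hactive : (c.proc i).phase = .active)
      (hread : readTarget i (c.proc i).pc = some ρ) :
      Step i c (c.setProc i (afterRead (c.proc i) (c.reg ρ)))
  | respondReadDisturbed (c : Config n φ K) (ρ : RegName n) (v : Fin K)
      (hdisturbed : (c.proc i).phase = .disturbed)
      (hread : readTarget i (c.proc i).pc = some ρ) :
      Step i c (c.setProc i (afterRead (c.proc i) v))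
  | invokeWrite (c : Config n φ K) (ρ : RegName n) (hready : (c.proc i).phase = .ready)
      (hwrite : writeTarget i (c.proc i).pc = some ρ) :
      Step i c ((c.disturb ρ).setProc i { c.proc i with phase := .active })
  | respondWrite (c : Config n φ K) (ρ : RegName n) (hinvoked : (c.proc i).phase ≠ .ready)
      (hwrite : writeTarget i (c.proc i).pc = some ρ) :
      Step i c { proc := Function.update c.proc i (afterWrite (c.proc i))
                 reg := Function.update c.reg ρ (c.proc i).x }
  | localStep (c : Config n φ K) (hlocal : (c.proc i).pc.IsLocal) :
      Step i c (c.setProc i (afterLocal i (c.proc i)))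

/-- An (asynchronous, fair) execution: the steps of the processors are interleaved arbitrarily,
and every processor takes infinitely many steps. The initial configuration is unrestricted. -/
def IsExecution (c : ℕ → Config n φ K) : Prop :=
  ∃ sched : ℕ → Fin n, (∀ t, Step (sched t) (c t) (c (t + 1))) ∧ ∀ i, ∀ t, ∃ u, t ≤ u ∧ sched u = i

/-- `p_i` is in its critical section. -/
def InCrit (c : Config n φ K) (i : Fin n) : Prop := (c.proc i).pc = .crit

/-- Specification of mutual exclusion by a circulating token: there are never two processors in
the critical section, every processor is in it infinitely often, and the right to enter it
advances along the ring: the next visit after a visit of `p_i` is one of its successor. -/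
def MutualExclusion (c : ℕ → Config n φ K) : Prop :=
  (∀ t i j, InCrit (c t) i → InCrit (c t) j → i = j) ∧
  (∀ i t, ∃ u, t ≤ u ∧ InCrit (c u) i) ∧
  (∀ s t i j, s < t → InCrit (c s) i → ¬ InCrit (c (s + 1)) i → InCrit (c t) j →
    (∀ u, s < u → u < t → ∀ k, ¬ InCrit (c u) k) → j = next i)

/-- The two-register protocol is self-stabilizing to mutual exclusion: there is a set of legitimate
configurations that is closed under steps, from which every execution satisfies mutual exclusion,
and that every execution, from any configuration at all, reaches. -/
def SelfStabilizing (n φ K : ℕ) : Prop :=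
  ∃ L : Set (Config n φ K),
    (∀ i c c', c ∈ L → Step i c c' → c' ∈ L) ∧
    (∀ c : ℕ → Config n φ K, IsExecution c → c 0 ∈ L → MutualExclusion c) ∧
    (∀ c : ℕ → Config n φ K, IsExecution c → ∃ t, c t ∈ L)

end TokenRing

namespace TokenRing

open Filter

variable {n φ K : ℕ}

/-! Local consistency. After the first `AWrite` that a processor begins regularly, its registers and
local variables agree for ever (`Clean`, `IsExecution.eventually_clean`). From then on its history
is a numbered sequence of values: a value is issued on entering the critical section, stays pending
through the write to `R_a`, and is committed, that is, offered to the successor, when the write to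
`R_b` is invoked.

Safe reads. Garbage costs the writer a commit: `R_a` can yield something other than the offered
value only if a value is pending at some moment of the read, and `R_b` only if none is. An iteration
of a scan that gets only unoffered values therefore contains a commit, and a scan with a common
result either returns a value offered during the scan or has seen `φ` commits
(`CleanRun.fire_offered`). Two successive firings cannot use the same version of the predecessor, so
a processor issues at most two values more than its predecessor commits. Composed around the ring,
this says that the predecessor of a processor standing still commits at most `2 (n - 1) < φ` times.
The overrun is thus impossible, and every firing that issues a value numbered at least 2 copies a
genuine version of the predecessor, in strictly increasing order (`CleanRun.exists_isSource`).

Synchronization. When `p_0` fires with more than `2 n` values issued, the value it has read is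
traced back around the ring to a version of `p_0` itself. The version number drops by at most 2 per
link and `p_0` counts modulo `K > 2 n`, so this is its current value; it has gone all the way round
and nobody can be ahead of it (`CleanRun.exists_synced`). Afterwards the slacks of all links and the
number of pending values add up to 1: there is one token (`Synced.of_pend`).

Liveness. In a deadlock every `p_i` with `i ≠ 0` would agree with its predecessor and `p_0` would
not, which is absurd on a ring (`CleanRun.frequently_fire`); the bound per link spreads infinitely
many firings from one processor to all. -/

theorem writeTarget_eq_some {i k : Fin n} {p : Pc φ} {r : Side}
    (h : writeTarget k p = some (i, r)) : k = i ∧ p = .awWrite r := by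
  cases p <;> simp_all [writeTarget]

theorem beingWritten_iff {c : Config n φ K} {i : Fin n} {r : Side} :
    BeingWritten c (i, r) ↔ (c.proc i).pc = .awWrite r ∧ (c.proc i).phase ≠ .ready := by
  constructor
  · rintro ⟨j, hj, hp⟩
    obtain ⟨rfl, h⟩ := writeTarget_eq_some hj
    exact ⟨h, hp⟩
  · rintro ⟨h, hp⟩
    exact ⟨i, by rw [h]; rfl, hp⟩

/-- A step changes the registers of the acting processor only. -/
theorem Step.reg_other {i k : Fin n} {c c' : Config n φ K} (h : Step k c c') (hik : i ≠ k)
    (r : Side) : c'.reg (i, r) = c.reg (i, r) := by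
  cases h with
  | respondWrite ρ _ hw =>
    obtain ⟨j, r'⟩ := ρ
    obtain ⟨rfl, -⟩ := writeTarget_eq_some hw
    simp [Function.update, hik]
  | _ => rfl

/-- A step changes the local state of another processor at most by disturbing its pending read. -/
theorem Step.proc_other {i k : Fin n} {c c' : Config n φ K} (h : Step k c c') (hik : i ≠ k) :
    c'.proc i = c.proc i ∨
      ∃ r, readTarget i (c.proc i).pc = some (k, r) ∧ (c.proc i).phase ≠ .ready ∧
        (c.proc k).pc = .awWrite r ∧ (c'.proc k) = { c.proc k with phase := .active } ∧
        c'.reg = c.reg ∧ c'.proc i = { c.proc i with phase := .disturbed } := by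
  cases h with
  | invokeWrite ρ hr hw =>
    obtain ⟨j, r'⟩ := ρ
    obtain ⟨rfl, hpc⟩ := writeTarget_eq_some hw
    by_cases hc : readTarget i (c.proc i).pc = some (k, r') ∧ (c.proc i).phase ≠ .ready
    · right
      refine ⟨r', hc.1, hc.2, hpc, ?_, rfl, ?_⟩
      · simp [Config.setProc]
      · simp [Config.setProc, Config.disturb, hik, hc.1, hc.2]
    · left
      simp only [Config.setProc, Config.disturb, Function.update_of_ne hik, if_neg hc]
  | _ => left; simp [Config.setProc, hik]

/-! ### The local invariant, and the effect of one step on offered and newest values -/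

/-- The local invariant of `p_i`, established by its first complete `AWrite`. -/
def Clean (i : Fin n) (c : Config n φ K) : Prop :=
  match (c.proc i).pc with
  | .readOwn => c.reg (i, .a) = c.reg (i, .b) ∧ (c.proc i).phase ≠ .disturbed
  | .scan _ _ => (c.proc i).x = c.reg (i, .a) ∧ c.reg (i, .a) = c.reg (i, .b)
  | .areadReturn => (c.proc i).x = c.reg (i, .a) ∧ c.reg (i, .a) = c.reg (i, .b)
  | .test => (c.proc i).x = c.reg (i, .a) ∧ c.reg (i, .a) = c.reg (i, .b)
  | .crit => (c.proc i).x ≠ c.reg (i, .b) ∧ c.reg (i, .a) = c.reg (i, .b)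
  | .awRead .a => c.reg (i, .a) = c.reg (i, .b) ∧ (c.proc i).phase ≠ .disturbed
  | .awRead .b => c.reg (i, .a) = c.reg (i, .b) ∧ (c.proc i).phase ≠ .disturbed ∧
      (c.proc i).wA = c.reg (i, .a)
  | .awTest => c.reg (i, .a) = c.reg (i, .b) ∧ (c.proc i).wA = c.reg (i, .a) ∧
      (c.proc i).wB = c.reg (i, .a)
  | .awWrite .a => (c.proc i).x ≠ c.reg (i, .b) ∧ c.reg (i, .a) = c.reg (i, .b)
  | .awWrite .b => (c.proc i).x = c.reg (i, .a) ∧ c.reg (i, .a) ≠ c.reg (i, .b)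

/-- The value offered by `p_i` to its successor; it changes when a write to `R_b` is invoked. -/
def eff (i : Fin n) (c : Config n φ K) : Fin K :=
  match (c.proc i).pc, (c.proc i).phase with
  | .awWrite .b, .active => (c.proc i).x
  | .awWrite .b, .disturbed => (c.proc i).x
  | _, _ => c.reg (i, .b)

/-- The most recent value chosen by `p_i`. -/
def newest (i : Fin n) (c : Config n φ K) : Fin K :=
  match (c.proc i).pc with
  | .readOwn | .scan _ _ | .areadReturn | .test => c.reg (i, .b)
  | _ => (c.proc i).x

/-- `p_i` has chosen a new value which it does not yet offer to its successor. -/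
def Pend (i : Fin n) (c : Config n φ K) : Prop := newest i c ≠ eff i c

/-- `p_i` enters the critical section. -/
def Fire (i : Fin n) (c c' : Config n φ K) : Prop :=
  (c.proc i).pc = .test ∧ (c'.proc i).pc = .crit

theorem incMod_ne (hK : 1 < K) (x : Fin K) : incMod x ≠ x := by
  intro h
  have h := congrArg Fin.val h
  simp only [incMod] at h
  rcases Nat.lt_or_ge (x.val + 1) K with h1 | h1
  · rw [Nat.mod_eq_of_lt h1] at h; omega
  · have : x.val + 1 = K := by omega
    rw [this, Nat.mod_self] at h; omega

/-- Clean, eff and newest do not depend on the phase of a pending read of the predecessor. -/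
theorem Step.local_other {i k : Fin n} {c c' : Config n φ K} (h : Step k c c') (hik : i ≠ k) :
    (Clean i c → Clean i c') ∧ eff i c' = eff i c ∧ newest i c' = newest i c ∧
      (c'.proc i).pc = (c.proc i).pc := by
  have hr := h.reg_other hik
  rcases h.proc_other hik with hp | ⟨r, hrt, hph, -, -, -, hp⟩
  · simp [Clean, eff, newest, hp, hr]
  · have hk : ∀ r', (i, r') ≠ (k, r) := fun r' h' => hik (congrArg Prod.fst h')
    simp only [Clean, eff, newest, hp, hr]
    cases hpc : (c.proc i).pc with
    | awWrite r' => simp [readTarget, hpc] at hrt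
    | readOwn => simp [readTarget, hpc] at hrt; exact absurd hrt.1 hik
    | awRead r' => simp [readTarget, hpc] at hrt; exact absurd hrt.1 hik
    | _ => simp

theorem afterTest_cases (i : Fin n) (s : Proc φ K) :
    (∃ y, s.y = some y ∧ i.val ≠ 0 ∧ y ≠ s.x ∧
      afterTest i s = { s with x := y, pc := .crit, phase := .ready }) ∨
    (i.val = 0 ∧ s.y = some s.x ∧
      afterTest i s = { s with x := incMod s.x, pc := .crit, phase := .ready }) ∨
    ((∀ y, s.y = some y → (i.val ≠ 0 → y = s.x) ∧ (i.val = 0 → y ≠ s.x)) ∧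
      afterTest i s = { s with pc := .awRead .a, phase := .ready }) := by
  unfold afterTest
  cases hy : s.y with
  | none => simp
  | some y =>
    by_cases h1 : i.val ≠ 0 ∧ s.x ≠ y
    · exact .inl ⟨y, rfl, h1.1, h1.2.symm, by simp only [if_pos h1]⟩
    · by_cases h2 : i.val = 0 ∧ y = s.x
      · exact .inr (.inl ⟨h2.1, by rw [h2.2], by simp only [if_neg h1, if_pos h2]⟩)
      · refine .inr (.inr ⟨?_, by simp only [if_neg h1, if_neg h2]⟩)
        rintro z ⟨⟩
        exact ⟨fun h => by by_contra hne; exact h1 ⟨h, fun e => hne e.symm⟩, fun h e => h2 ⟨h, e⟩⟩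

/-- A processor is sequential and the only writer of its registers, so its reads of them are never
disturbed by its own writes. `AWrite` therefore sees the true contents and writes only a value that
differs from both registers. -/
theorem Clean.own {i : Fin n} {c c' : Config n φ K} (hK : 1 < K) (hc : Clean i c)
    (h : Step i c c') : Clean i c' := by
  cases h with
  | invokeRead ρ hr hrt hq =>
    cases hpc : (c.proc i).pc with
    | awRead r => cases r <;> simp_all [Clean, Config.setProc]
    | awWrite r => simp_all [readTarget]
    | _ => simp_all [Clean, Config.setProc]
  | invokeReadDisturbed ρ hr hrt hq =>
    cases hpc : (c.proc i).pc with
    | awRead r =>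
      simp only [hpc, readTarget, Option.some.injEq] at hrt
      subst hrt; rw [beingWritten_iff] at hq; simp_all
    | awWrite r => simp_all [readTarget]
    | readOwn =>
      simp only [hpc, readTarget, Option.some.injEq] at hrt
      subst hrt; rw [beingWritten_iff] at hq; simp_all
    | _ => simp_all [Clean, Config.setProc]
  | respondRead ρ ha hrt =>
    cases hpc : (c.proc i).pc with
    | awRead r =>
      simp only [hpc, readTarget, Option.some.injEq] at hrt
      subst hrt
      cases r <;> simp_all [Clean, Config.setProc, afterRead]
    | readOwn =>
      simp only [hpc, readTarget, Option.some.injEq] at hrt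
      subst hrt
      simp only [Clean, hpc] at hc
      simp only [Clean, Config.setProc, afterRead, hpc, Function.update_self, scanFrom]
      split_ifs <;> simp [hc]
    | scan j r =>
      simp only [Clean, hpc] at hc
      cases r <;> simp only [Clean, Config.setProc, afterRead, hpc, Function.update_self, scanFrom]
      · exact hc
      · split_ifs <;> exact hc
    | _ => simp_all [readTarget]
  | respondReadDisturbed ρ v ha hrt =>
    cases hpc : (c.proc i).pc with
    | scan j r =>
      simp only [Clean, hpc] at hc
      cases r <;> simp only [Clean, Config.setProc, afterRead, hpc, Function.update_self, scanFrom]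
      · exact hc
      · split_ifs <;> exact hc
    | awRead r => cases r <;> simp_all [Clean]
    | readOwn => simp_all [Clean]
    | _ => simp_all [readTarget]
  | invokeWrite ρ hr hw =>
    obtain ⟨j, r⟩ := ρ
    obtain ⟨-, hpc⟩ := writeTarget_eq_some hw
    cases r <;> simp_all [Clean, Config.setProc, Config.disturb]
  | respondWrite ρ hr hw =>
    obtain ⟨j, r⟩ := ρ
    obtain ⟨rfl, hpc⟩ := writeTarget_eq_some hw
    cases r <;> simp_all [Clean, afterWrite]
  | localStep hl =>
    cases hpc : (c.proc i).pc with
    | areadReturn => simp_all [Clean, Config.setProc, afterLocal]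
    | crit => simp_all [Clean, Config.setProc, afterLocal]
    | awTest =>
      simp only [Clean, hpc] at hc
      simp only [Clean, Config.setProc, afterLocal, hpc, Function.update_self]
      split_ifs with hx
      · simp [hc.1]
      · refine ⟨fun h => hx ?_, hc.1⟩
        simp_all
    | test =>
      simp only [Clean, hpc] at hc
      rcases afterTest_cases i (c.proc i) with ⟨y, -, -, hne, e⟩ | ⟨-, -, e⟩ | ⟨-, e⟩
      · simp_all [Clean, Config.setProc, afterLocal]
      · simp_all [Clean, Config.setProc, afterLocal, incMod_ne hK]
      · simp_all [Clean, Config.setProc, afterLocal]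
    | _ => simp_all [Pc.IsLocal]

theorem Clean.step {i k : Fin n} {c c' : Config n φ K} (hK : 1 < K) (hc : Clean i c)
    (h : Step k c c') : Clean i c' := by
  by_cases hik : i = k
  · subst hik; exact hc.own hK h
  · exact (h.local_other hik).1 hc

theorem Fire.own {i k : Fin n} {c c' : Config n φ K} (h : Step k c c') (hf : Fire i c c') :
    i = k := by
  by_contra hik
  have := (h.local_other hik).2.2.2
  rw [hf.1, hf.2] at this
  cases this

/-- The firing rule. -/
theorem Step.fire_spec {i k : Fin n} {c c' : Config n φ K} (hK : 1 < K) (hc : Clean i c)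
    (h : Step k c c') (hf : Fire i c c') :
    ¬ Pend i c ∧ Pend i c' ∧ eff i c' = eff i c ∧
    ∃ y, (c.proc i).y = some y ∧
      ((i.val ≠ 0 ∧ newest i c ≠ y ∧ newest i c' = y) ∨
       (i.val = 0 ∧ newest i c = y ∧ newest i c' = incMod y)) := by
  obtain rfl := hf.own h
  obtain ⟨hpc, hpc'⟩ := hf
  simp only [Clean, hpc] at hc
  cases h with
  | localStep hl =>
    rcases afterTest_cases i (c.proc i) with ⟨y, hy, h0, hne, e⟩ | ⟨h0, hy, e⟩ | ⟨-, e⟩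
    · have h3 := hne.symm
      simp_all [Config.setProc, afterLocal, Pend, newest, eff]
    · simp_all [Config.setProc, afterLocal, Pend, newest, eff, incMod_ne hK]
    · simp_all [Config.setProc, afterLocal]
  | _ => simp_all [readTarget, writeTarget]

/-- Apart from firings, a step keeps the newest value; the effective value either stays or becomes
the newest one. -/
theorem Step.newest_eff {i k : Fin n} {c c' : Config n φ K} (hc : Clean i c)
    (h : Step k c c') (hf : ¬ Fire i c c') :
    newest i c' = newest i c ∧ (eff i c' = eff i c ∨ eff i c' = newest i c) := by
  by_cases hik : i = k
  swap
  · have := h.local_other hik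
    exact ⟨this.2.2.1, .inl this.2.1⟩
  subst hik
  cases h with
  | invokeRead ρ hr hrt hq =>
    cases hpc : (c.proc i).pc <;> simp_all [newest, eff, Config.setProc, readTarget]
  | invokeReadDisturbed ρ hr hrt hq =>
    cases hpc : (c.proc i).pc <;> simp_all [newest, eff, Config.setProc, readTarget]
  | respondRead ρ ha hrt =>
    cases hpc : (c.proc i).pc with
    | awRead r => cases r <;> simp_all [newest, eff, Config.setProc, afterRead]
    | readOwn =>
      simp only [newest, eff, Config.setProc, afterRead, hpc, Function.update_self, scanFrom]
      split_ifs <;> simp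
    | scan j r =>
      cases r <;>
        simp only [newest, eff, Config.setProc, afterRead, hpc, Function.update_self, scanFrom]
      · simp
      · split_ifs <;> simp
    | _ => simp_all [readTarget]
  | respondReadDisturbed ρ v ha hrt =>
    cases hpc : (c.proc i).pc with
    | awRead r => cases r <;> simp_all [newest, eff, Config.setProc, afterRead]
    | readOwn =>
      simp only [newest, eff, Config.setProc, afterRead, hpc, Function.update_self, scanFrom]
      split_ifs <;> simp
    | scan j r =>
      cases r <;>
        simp only [newest, eff, Config.setProc, afterRead, hpc, Function.update_self, scanFrom]
      · simp
      · split_ifs <;> simp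
    | _ => simp_all [readTarget]
  | invokeWrite ρ hr hw =>
    obtain ⟨j, r⟩ := ρ
    obtain ⟨-, hpc⟩ := writeTarget_eq_some hw
    cases r <;> simp_all [newest, eff, Config.setProc, Config.disturb]
  | respondWrite ρ hr hw =>
    obtain ⟨j, r⟩ := ρ
    obtain ⟨rfl, hpc⟩ := writeTarget_eq_some hw
    cases hph : (c.proc i).phase <;> cases r <;> simp_all [newest, eff, afterWrite, Clean]
  | localStep hl =>
    cases hpc : (c.proc i).pc with
    | areadReturn => simp_all [newest, eff, Config.setProc, afterLocal]
    | crit => simp_all [newest, eff, Config.setProc, afterLocal]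
    | awTest =>
      simp only [Clean, hpc] at hc
      simp only [newest, eff, Config.setProc, afterLocal, hpc, Function.update_self]
      split_ifs with hx
      · simp only [← hx.1, hc]; simp
      · simp
    | test =>
      simp only [Clean, hpc] at hc
      rcases afterTest_cases i (c.proc i) with ⟨y, hy, h0, hne, e⟩ | ⟨h0, hy, e⟩ | ⟨-, e⟩
      · simp_all [Fire, Config.setProc, afterLocal]
      · simp_all [Fire, Config.setProc, afterLocal]
      · simp_all [newest, eff, Config.setProc, afterLocal]
    | _ => simp_all [Pc.IsLocal]

theorem Step.fire_of_enter {i k : Fin n} {c c' : Config n φ K} (h : Step k c c')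
    (h1 : ¬ InCrit c i) (h2 : InCrit c' i) : Fire i c c' := by
  refine ⟨?_, h2⟩
  unfold InCrit at h1 h2
  by_cases hik : i = k
  swap
  · exact absurd ((h.local_other hik).2.2.2 ▸ h2) h1
  subst hik
  cases h with
  | invokeRead ρ hr hrt hq => simp_all [Config.setProc]
  | invokeReadDisturbed ρ hr hrt hq => simp_all [Config.setProc]
  | respondRead ρ ha hrt =>
    simp only [Config.setProc, Function.update_self, afterRead, scanFrom] at h2
    split at h2 <;> (try split_ifs at h2) <;> simp_all
  | respondReadDisturbed ρ v ha hrt =>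
    simp only [Config.setProc, Function.update_self, afterRead, scanFrom] at h2
    split at h2 <;> (try split_ifs at h2) <;> simp_all
  | invokeWrite ρ hr hw => simp_all [Config.setProc, Config.disturb]
  | respondWrite ρ hr hw =>
    simp only [Function.update_self, afterWrite] at h2
    split at h2 <;> simp_all
  | localStep hl =>
    simp only [Config.setProc, Function.update_self, afterLocal] at h2
    split at h2 <;> (try split_ifs at h2) <;> simp_all

theorem not_pend_of_pc {i : Fin n} {c : Config n φ K}
    (h : (c.proc i).pc = .readOwn ∨ (∃ j r, (c.proc i).pc = .scan j r) ∨
      (c.proc i).pc = .areadReturn ∨ (c.proc i).pc = .test) : ¬ Pend i c := by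
  rcases h with h | ⟨j, r, h⟩ | h | h <;> simp [Pend, newest, eff, h]

/-- This reduces mutual exclusion to counting pending values. -/
theorem Clean.pend_of_inCrit {i : Fin n} {c : Config n φ K} (hc : Clean i c) (h : InCrit c i) :
    Pend i c := by
  have h : (c.proc i).pc = .crit := h
  simp_all [Clean, Pend, newest, eff]

/-! ### Numbering the values of a processor -/

/-- A sequence of steps in which all processors satisfy their local invariants. -/
structure CleanRun (c : ℕ → Config n φ K) : Prop where
  step : ∀ t, ∃ k, Step k (c t) (c (t + 1))
  clean : ∀ t i, Clean i (c t)

open Classical in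
/-- The number of values that `p_i` has begun to offer to its successor before time `t`. -/
noncomputable def commits (c : ℕ → Config n φ K) (i : Fin n) : ℕ → ℕ
  | 0 => 0
  | t + 1 => commits c i t + if Pend i (c t) ∧ ¬ Pend i (c (t + 1)) then 1 else 0

open Classical in
/-- The number of values chosen by `p_i`; a value that is pending initially is included. -/
noncomputable def issued (c : ℕ → Config n φ K) (i : Fin n) (t : ℕ) : ℕ :=
  commits c i t + if Pend i (c t) then 1 else 0

/-- `p_i` enters the critical section at time `t`. -/
def FireAt (c : ℕ → Config n φ K) (i : Fin n) (t : ℕ) : Prop := Fire i (c t) (c (t + 1))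

open Classical in
/-- The `k`-th value of `p_i`. -/
noncomputable def val (c : ℕ → Config n φ K) (i : Fin n) (k : ℕ) : Fin K :=
  if h : ∃ t, issued c i t = k then newest i (c h.choose) else eff i (c 0)

section

variable {c : ℕ → Config n φ K} {i : Fin n}

theorem commits_mono (c : ℕ → Config n φ K) (i : Fin n) : Monotone (commits c i) :=
  monotone_nat_of_le_succ fun _ => Nat.le_add_right _ _

theorem commits_le_issued (c : ℕ → Config n φ K) (i : Fin n) (t : ℕ) :
    commits c i t ≤ issued c i t := Nat.le_add_right _ _

theorem issued_of_not_pend {t : ℕ} (h : ¬ Pend i (c t)) : issued c i t = commits c i t := by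
  simp [issued, h]

theorem issued_of_pend {t : ℕ} (h : Pend i (c t)) : issued c i t = commits c i t + 1 := by
  simp [issued, h]

theorem CleanRun.fire_spec (hr : CleanRun c) (hK : 1 < K) {t : ℕ} (hf : FireAt c i t) :
    ¬ Pend i (c t) ∧ Pend i (c (t + 1)) ∧ eff i (c (t + 1)) = eff i (c t) ∧
    ∃ y, ((c t).proc i).y = some y ∧
      ((i.val ≠ 0 ∧ newest i (c t) ≠ y ∧ newest i (c (t + 1)) = y) ∨
       (i.val = 0 ∧ newest i (c t) = y ∧ newest i (c (t + 1)) = incMod y)) := by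
  obtain ⟨k, hk⟩ := hr.step t
  exact hk.fire_spec hK (hr.clean t i) hf

theorem CleanRun.issued_succ_of_fire (hr : CleanRun c) (hK : 1 < K) {t : ℕ} (hf : FireAt c i t) :
    issued c i (t + 1) = issued c i t + 1 ∧ commits c i (t + 1) = commits c i t := by
  obtain ⟨h1, h2, -⟩ := hr.fire_spec hK hf
  simp [issued, commits, h1, h2]

theorem CleanRun.newest_eff (hr : CleanRun c) {t : ℕ} (hf : ¬ FireAt c i t) :
    newest i (c (t + 1)) = newest i (c t) ∧
      (eff i (c (t + 1)) = eff i (c t) ∨ eff i (c (t + 1)) = newest i (c t)) := by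
  obtain ⟨k, hk⟩ := hr.step t
  exact hk.newest_eff (hr.clean t i) hf

theorem CleanRun.pend_of_succ (hr : CleanRun c) {t : ℕ} (hf : ¬ FireAt c i t)
    (h : Pend i (c (t + 1))) : Pend i (c t) := by
  obtain ⟨h1, h2⟩ := hr.newest_eff hf
  unfold Pend at *
  rcases h2 with h2 | h2 <;> rw [h1, h2] at h
  · exact h
  · exact absurd rfl h

theorem CleanRun.issued_succ_of_not_fire (hr : CleanRun c) {t : ℕ} (hf : ¬ FireAt c i t) :
    issued c i (t + 1) = issued c i t := by
  have := hr.pend_of_succ hf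
  by_cases h1 : Pend i (c t) <;> by_cases h2 : Pend i (c (t + 1)) <;>
    simp_all [issued, commits]

theorem CleanRun.issued_mono (hr : CleanRun c) (hK : 1 < K) (i : Fin n) :
    Monotone (issued c i) := by
  refine monotone_nat_of_le_succ fun t => ?_
  by_cases hf : FireAt c i t
  · rw [(hr.issued_succ_of_fire hK hf).1]; exact Nat.le_succ _
  · rw [hr.issued_succ_of_not_fire hf]

/-- A discrete intermediate value argument: `issued` grows only at firings, and by one each time. -/
theorem CleanRun.exists_fire (hr : CleanRun c) (hK : 1 < K) {s t k : ℕ} (hst : s ≤ t)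
    (hs : issued c i s ≤ k) (ht : k < issued c i t) :
    ∃ u, s ≤ u ∧ u < t ∧ issued c i u = k ∧ FireAt c i u := by
  induction t, hst using Nat.le_induction with
  | base => omega
  | succ t hst ih =>
    by_cases h : k < issued c i t
    · obtain ⟨u, h1, h2, h3⟩ := ih h
      exact ⟨u, h1, h2.trans (Nat.lt_succ_self _), h3⟩
    · by_cases hf : FireAt c i t
      · rw [(hr.issued_succ_of_fire hK hf).1] at ht
        exact ⟨t, hst, Nat.lt_succ_self _, by omega, hf⟩
      · rw [hr.issued_succ_of_not_fire hf] at ht; omega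

theorem CleanRun.newest_eq_of_issued_eq (hr : CleanRun c) (hK : 1 < K) {s t : ℕ} (hst : s ≤ t)
    (h : issued c i s = issued c i t) : newest i (c s) = newest i (c t) := by
  induction t, hst using Nat.le_induction with
  | base => rfl
  | succ t hst ih =>
    have h1 := hr.issued_mono hK i hst
    have h2 := hr.issued_mono hK i (Nat.le_succ t)
    have hf : ¬ FireAt c i t := fun hf => by
      have := (hr.issued_succ_of_fire hK hf).1; omega
    rw [(hr.newest_eff hf).1]
    exact ih (by simp only [Nat.succ_eq_add_one] at h2; omega)

theorem CleanRun.eff_eq_of_commits_eq (hr : CleanRun c) (hK : 1 < K) {s t : ℕ} (hst : s ≤ t)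
    (h : commits c i s = commits c i t) : eff i (c s) = eff i (c t) := by
  induction t, hst using Nat.le_induction with
  | base => rfl
  | succ t hst ih =>
    have h1 := commits_mono c i hst
    have h2 := commits_mono c i (Nat.le_succ t)
    simp only [Nat.succ_eq_add_one] at h2
    rw [ih (by omega)]
    by_cases hf : FireAt c i t
    · exact (hr.fire_spec hK hf).2.2.1.symm
    · obtain ⟨h3, h4⟩ := hr.newest_eff hf
      rcases h4 with h4 | h4
      · exact h4.symm
      · have h5 : ¬ Pend i (c (t + 1)) := by simp [Pend, h3, h4]
        have h6 : ¬ Pend i (c t) := fun h6 => by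
          have : commits c i (t + 1) = commits c i t + 1 := by simp [commits, h5, h6]
          omega
        rw [h4]
        exact (not_not.1 h6).symm

theorem CleanRun.val_issued (hr : CleanRun c) (hK : 1 < K) (t : ℕ) :
    val c i (issued c i t) = newest i (c t) := by
  have h : ∃ s, issued c i s = issued c i t := ⟨t, rfl⟩
  rw [val, dif_pos h]
  rcases Nat.le_total h.choose t with h1 | h1
  · exact hr.newest_eq_of_issued_eq hK h1 h.choose_spec
  · exact (hr.newest_eq_of_issued_eq hK h1 h.choose_spec.symm).symm

/-- Without a pending value the offered value is the newest one. With one, the offered value is what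
was newest just before the firing that made it pending. -/
theorem CleanRun.val_commits (hr : CleanRun c) (hK : 1 < K) (t : ℕ) :
    val c i (commits c i t) = eff i (c t) := by
  by_cases hp : Pend i (c t)
  · have hit := issued_of_pend hp
    by_cases h0 : issued c i 0 ≤ commits c i t
    · obtain ⟨u, -, hut, hu, hf⟩ := hr.exists_fire hK (Nat.zero_le t) h0 (by omega)
      have hpu := (hr.fire_spec hK hf).1
      rw [← hu, hr.val_issued hK]
      refine (not_not.1 hpu).trans (hr.eff_eq_of_commits_eq hK hut.le ?_)
      rw [← hu, issued_of_not_pend hpu]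
    -- Here a value is pending from the start and nothing has been committed yet. Then `issued`
    -- never takes the value 0, and version 0 is the default in `val`, the value offered initially.
    · have hc : commits c i 0 = 0 := rfl
      have h1 : issued c i 0 ≤ commits c i 0 + 1 := by
        unfold issued; split_ifs <;> omega
      have hno : ¬ ∃ s, issued c i s = commits c i t := by
        rintro ⟨s, hs⟩
        have := hr.issued_mono hK i (Nat.zero_le s)
        omega
      rw [val, dif_neg hno]
      exact hr.eff_eq_of_commits_eq hK (Nat.zero_le t) (by omega)
  · rw [← issued_of_not_pend hp, hr.val_issued hK]
    exact not_not.1 hp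

/-- The run that begins at time `s`. -/
def tailFrom (c : ℕ → Config n φ K) (s : ℕ) : ℕ → Config n φ K := fun t => c (s + t)

theorem CleanRun.tail (hr : CleanRun c) (s : ℕ) : CleanRun (tailFrom c s) :=
  ⟨fun t => hr.step (s + t), fun t => hr.clean (s + t)⟩

theorem commits_tailFrom (c : ℕ → Config n φ K) (i : Fin n) (s t : ℕ) :
    commits c i (s + t) = commits c i s + commits (tailFrom c s) i t := by
  induction t with
  | zero => rfl
  | succ t ih =>
    rw [← Nat.add_assoc, commits, commits, ih]
    simp only [tailFrom, Nat.add_assoc]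
    rfl

end

/-! ### Scans: an unoffered value is seen only at the price of a commit -/

/-- `R_a` is written before the commit, so it can be ahead of the offered value but never behind it.
-/
theorem Clean.pend_of_reg_a_ne {w : Fin n} {c : Config n φ K} (hc : Clean w c)
    (h : c.reg (w, .a) ≠ eff w c) : Pend w c := by
  cases hpc : (c.proc w).pc with
  | awWrite r => cases r <;> cases hph : (c.proc w).phase <;> simp_all [Clean, eff, Pend, newest]
  | awRead r => cases r <;> simp_all [Clean, eff]
  | _ => simp_all [Clean, eff]

/-- `R_b` can only lag behind the offered value, between the invocation of its write (the commit)
and the response. -/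
theorem not_pend_of_reg_b_ne {w : Fin n} {c : Config n φ K}
    (h : c.reg (w, .b) ≠ eff w c) : ¬ Pend w c := by
  cases hpc : (c.proc w).pc with
  | awWrite r => cases r <;> cases hph : (c.proc w).phase <;> simp_all [eff, Pend, newest]
  | _ => simp_all [eff]

theorem Clean.pend_of_writing_a {w : Fin n} {c : Config n φ K} (hc : Clean w c)
    (h : (c.proc w).pc = .awWrite .a) : Pend w c := by
  simp_all [Clean, eff, Pend, newest]

theorem not_pend_of_writing_b {w : Fin n} {c : Config n φ K}
    (h : (c.proc w).pc = .awWrite .b) (h' : (c.proc w).phase ≠ .ready) : ¬ Pend w c := by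
  cases hph : (c.proc w).phase <;> simp_all [eff, Pend, newest]

/-- The processor is between the start of `ARead` and the following test. -/
def Pc.IsScanning : Pc φ → Prop
  | .scan _ _ | .areadReturn | .test => True
  | _ => False

theorem not_pend_of_isScanning {i : Fin n} {c : Config n φ K} (h : (c.proc i).pc.IsScanning) :
    ¬ Pend i c := by
  cases hpc : (c.proc i).pc <;> simp_all [Pc.IsScanning, Pend, newest, eff]

/-- One of the first `a` entries of `A` or of the first `b` entries of `B` satisfies `P`. -/
def Proc.HasEntry (s : Proc φ K) (a b : ℕ) (P : Fin K → Prop) : Prop :=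
  (∃ m : Fin φ, m.val < a ∧ P (s.A m)) ∨ ∃ m : Fin φ, m.val < b ∧ P (s.B m)

/-- Between the times `s` and `t`, `p_w` has offered the value `v`. -/
def Offered (c : ℕ → Config n φ K) (w : Fin n) (s t : ℕ) (v : Fin K) : Prop :=
  ∃ u, s ≤ u ∧ u ≤ t ∧ eff w (c u) = v

/-- State at time `t` of a scan of `p_w` by `p_j` that began at time `s`: some value read has been
offered since then, or every iteration completed so far has seen a commit of `p_w`. -/
def ScanInv (c : ℕ → Config n φ K) (w j : Fin n) (s t : ℕ) : Prop :=
  match ((c t).proc j).pc with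
  | .scan m .a => ((c t).proc j).HasEntry m m (Offered c w s t) ∨
      commits c w s + m ≤ commits c w t ∧
        (((c t).proc j).phase = .disturbed → commits c w s + m + 1 ≤ issued c w t)
  | .scan m .b => ((c t).proc j).HasEntry (m + 1) m (Offered c w s t) ∨
      commits c w s + m + 1 ≤ issued c w t ∧
        (((c t).proc j).phase = .disturbed → commits c w s + m + 1 ≤ commits c w t)
  | .areadReturn => ((c t).proc j).HasEntry φ φ (Offered c w s t) ∨
      commits c w s + φ ≤ commits c w t
  | .test => ∀ y, ((c t).proc j).y = some y → Offered c w s t y ∨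
      commits c w s + φ ≤ commits c w t
  | _ => True

section

variable {c : ℕ → Config n φ K} {w j : Fin n} {s t : ℕ}

theorem Offered.succ {v : Fin K} (h : Offered c w s t v) : Offered c w s (t + 1) v := by
  obtain ⟨u, h1, h2, h3⟩ := h
  exact ⟨u, h1, h2.trans (Nat.le_succ t), h3⟩

theorem Proc.HasEntry.mono {p p' : Proc φ K} {a b a' b' : ℕ} {P P' : Fin K → Prop}
    (h : p.HasEntry a b P) (hA : ∀ m : Fin φ, m.val < a → m.val < a' ∧ p'.A m = p.A m)
    (hB : ∀ m : Fin φ, m.val < b → m.val < b' ∧ p'.B m = p.B m) (hP : ∀ v, P v → P' v) :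
    p'.HasEntry a' b' P' := by
  rcases h with ⟨m, h1, h2⟩ | ⟨m, h1, h2⟩
  · exact .inl ⟨m, (hA m h1).1, by rw [(hA m h1).2]; exact hP _ h2⟩
  · exact .inr ⟨m, (hB m h1).1, by rw [(hB m h1).2]; exact hP _ h2⟩

theorem scanResult_eq_some {A B : Fin φ → Fin K} {v : Fin K} (h : scanResult A B = some v)
    (m : Fin φ) : A m = v ∧ B m = v := by
  unfold scanResult at h
  split_ifs at h with h1 h2
  simp only [Option.some.injEq] at h
  rw [← h]; exact h2 m

/-- Counts and the set of offered values only grow. The one delicate step is the invocation of a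
write that disturbs the pending read: on `R_a` it shows a pending value, on `R_b` it is itself past
the commit, which is what the invariant demands of a disturbed read. -/
theorem ScanInv.other (hr : CleanRun c) (hK : 1 < K) (hw : w = prev j) {k : Fin n}
    (hk : Step k (c t) (c (t + 1))) (hjk : j ≠ k) (h : ScanInv c w j s t) :
    ScanInv c w j s (t + 1) := by
  have hcm := commits_mono c w (Nat.le_succ t)
  have him := hr.issued_mono hK w (Nat.le_succ t)
  simp only [Nat.succ_eq_add_one] at hcm him
  rcases hk.proc_other hjk with hp | ⟨r, hrt, hph, hpk, hpk', -, hp⟩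
  · unfold ScanInv at h ⊢
    rw [hp]
    cases hpc : ((c t).proc j).pc with
    | scan m r =>
      rw [hpc] at h
      cases r with
      | a =>
        refine h.imp (fun h => h.mono (by simp) (by simp) fun _ => Offered.succ) fun h => ?_
        exact ⟨h.1.trans hcm, fun hd => (h.2 hd).trans him⟩
      | b =>
        refine h.imp (fun h => h.mono (by simp) (by simp) fun _ => Offered.succ) fun h => ?_
        exact ⟨h.1.trans him, fun hd => (h.2 hd).trans hcm⟩
    | areadReturn =>
      rw [hpc] at h
      exact h.imp (fun h => h.mono (by simp) (by simp) fun _ => Offered.succ) fun h => h.trans hcm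
    | test =>
      rw [hpc] at h
      exact fun y hy => (h y hy).imp Offered.succ fun h => h.trans hcm
    | _ => trivial
  · unfold ScanInv at h ⊢
    rw [hp]
    cases hpc : ((c t).proc j).pc with
    | scan m r' =>
      rw [hpc] at h
      simp only [hpc, readTarget, Option.some.injEq, Prod.mk.injEq] at hrt
      obtain ⟨rfl, rfl⟩ := hrt
      subst hw
      cases r' with
      | a =>
        refine h.imp (fun h => h.mono (by simp) (by simp) fun _ => Offered.succ) fun h => ?_
        have hpd : Pend (prev j) (c (t + 1)) :=
          (hr.clean (t + 1) _).pend_of_writing_a (by rw [hpk', ← hpk])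
        exact ⟨h.1.trans hcm, fun _ => by rw [issued_of_pend hpd]; have := h.1; omega⟩
      | b =>
        refine h.imp (fun h => h.mono (by simp) (by simp) fun _ => Offered.succ) fun h => ?_
        have hpd : ¬ Pend (prev j) (c (t + 1)) :=
          not_pend_of_writing_b (by rw [hpk', ← hpk]) (by rw [hpk']; simp)
        rw [issued_of_not_pend hpd] at *
        exact ⟨h.1.trans him, fun _ => h.1.trans him⟩
    | readOwn => trivial
    | awRead _ => trivial
    | _ => simp [hpc, readTarget] at hrt

/-- An unoffered value from `R_a` means that a value is pending, so `issued` exceeds the commits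
counted so far; an unoffered value from `R_b` later means that nothing is pending, so `commits` has
caught up with `issued`. The two reads of one iteration thus enclose a commit. -/
theorem ScanInv.respond (hr : CleanRun c) (hK : 1 < K) (hst : s ≤ t)
    {m : Fin φ} {r : Side} {v : Fin K} (hpc : ((c t).proc j).pc = .scan m r)
    (hv : ((c t).proc j).phase = .disturbed ∨ v = (c t).reg (w, r))
    (hp : (c (t + 1)).proc j = afterRead ((c t).proc j) v) (h : ScanInv c w j s t) :
    ScanInv c w j s (t + 1) := by
  have hcm := commits_mono c w (Nat.le_succ t)
  have him := hr.issued_mono hK w (Nat.le_succ t)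
  simp only [Nat.succ_eq_add_one] at hcm him
  unfold ScanInv at h
  rw [hpc] at h
  cases r with
  | a =>
    simp only [afterRead, hpc] at hp
    unfold ScanInv
    rw [hp]
    simp only [reduceCtorEq, false_implies, and_true]
    rcases h with h | ⟨h1, h2⟩
    · left
      refine h.mono (fun m' hm' => ?_) (by simp) fun _ => Offered.succ
      have : m' ≠ m := fun e => by simp [e] at hm'
      exact ⟨by omega, by simp only [Function.update_of_ne this]⟩
    · rcases hv with hv | rfl
      · exact .inr ((h2 hv).trans him)
      · by_cases he : (c t).reg (w, .a) = eff w (c t)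
        · exact .inl (.inl ⟨m, by simp, t, hst, Nat.le_succ t, by simp [he]⟩)
        · have hpd := (hr.clean t w).pend_of_reg_a_ne he
          rw [issued_of_pend hpd] at him
          right; omega
  | b =>
    have key : ((c (t + 1)).proc j).HasEntry (m + 1) (m + 1) (Offered c w s (t + 1)) ∨
        commits c w s + (m + 1) ≤ commits c w (t + 1) := by
      rw [hp]
      simp only [afterRead, hpc]
      rcases h with h | ⟨h1, h2⟩
      · left
        refine h.mono (by simp) (fun m' hm' => ?_) fun _ => Offered.succ
        have : m' ≠ m := fun e => by simp [e] at hm'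
        exact ⟨by omega, by simp only [Function.update_of_ne this]⟩
      · rcases hv with hv | rfl
        · have := h2 hv
          right; omega
        · by_cases he : (c t).reg (w, .b) = eff w (c t)
          · exact .inl (.inr ⟨m, by simp, t, hst, Nat.le_succ t, by simp [he]⟩)
          · have hpd := not_pend_of_reg_b_ne he
            rw [issued_of_not_pend hpd] at h1
            right; omega
    by_cases hm : m.val + 1 < φ
    · have hpc' : ((c (t + 1)).proc j).pc = .scan ⟨m.val + 1, hm⟩ .a := by
        simp [hp, afterRead, hpc, scanFrom, hm]
      have hph' : ((c (t + 1)).proc j).phase = .ready := by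
        simp [hp, afterRead, hpc]
      unfold ScanInv
      rw [hpc']
      simp only [hph', reduceCtorEq, false_implies, and_true]
      exact key
    · have hpc' : ((c (t + 1)).proc j).pc = .areadReturn := by
        simp [hp, afterRead, hpc, scanFrom, hm]
      unfold ScanInv
      rw [hpc']
      have : m.val + 1 = φ := by omega
      rw [this] at key
      exact key

theorem ScanInv.own (hr : CleanRun c) (hK : 1 < K) (hw : w = prev j) (hst : s ≤ t)
    (hk : Step j (c t) (c (t + 1))) (hsc : ((c t).proc j).pc.IsScanning) (h : ScanInv c w j s t)
    (hsc' : ((c (t + 1)).proc j).pc.IsScanning) :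
    ScanInv c w j s (t + 1) := by
  have hcm := commits_mono c w (Nat.le_succ t)
  have him := hr.issued_mono hK w (Nat.le_succ t)
  simp only [Nat.succ_eq_add_one] at hcm him
  cases hpc : ((c t).proc j).pc with
  | scan m r =>
    generalize hc' : c (t + 1) = c' at hk
    cases hk with
    | invokeRead ρ hrd hrt hq =>
      have hp : (c (t + 1)).proc j = { (c t).proc j with phase := .active } := by
        simp [hc', Config.setProc]
      unfold ScanInv at h ⊢
      rw [hp]; simp only [hpc] at h ⊢
      cases r with
      | a =>
        refine h.imp (fun h => h.mono (by simp) (by simp) fun _ => Offered.succ) fun h => ?_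
        exact ⟨h.1.trans hcm, by simp⟩
      | b =>
        refine h.imp (fun h => h.mono (by simp) (by simp) fun _ => Offered.succ) fun h => ?_
        exact ⟨h.1.trans him, by simp⟩
    | invokeReadDisturbed ρ hrd hrt hq =>
      have hp : (c (t + 1)).proc j = { (c t).proc j with phase := .disturbed } := by
        simp [hc', Config.setProc]
      simp only [hpc, readTarget, Option.some.injEq] at hrt
      rw [← hrt, ← hw, beingWritten_iff] at hq
      unfold ScanInv at h ⊢
      rw [hp]; simp only [hpc] at h ⊢
      cases r with
      | a =>
        refine h.imp (fun h => h.mono (by simp) (by simp) fun _ => Offered.succ) fun h => ?_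
        have hpd := (hr.clean t _).pend_of_writing_a hq.1
        rw [issued_of_pend hpd] at him
        exact ⟨h.1.trans hcm, fun _ => by have := h.1; omega⟩
      | b =>
        refine h.imp (fun h => h.mono (by simp) (by simp) fun _ => Offered.succ) fun h => ?_
        have hpd := not_pend_of_writing_b hq.1 hq.2
        refine ⟨h.1.trans him, fun _ => ?_⟩
        rw [issued_of_not_pend hpd] at h
        exact h.1.trans hcm
    | respondRead ρ ha hrt =>
      simp only [hpc, readTarget, Option.some.injEq] at hrt
      refine h.respond hr hK hst hpc (v := (c t).reg ρ) (.inr (by rw [← hrt, hw])) ?_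
      simp [hc', Config.setProc]
    | respondReadDisturbed ρ v ha hrt =>
      refine h.respond hr hK hst hpc (v := v) (.inl ha) ?_
      simp [hc', Config.setProc]
    | invokeWrite ρ hrd hwt => simp [hpc, writeTarget] at hwt
    | respondWrite ρ hrd hwt => simp [hpc, writeTarget] at hwt
    | localStep hl => simp [hpc, Pc.IsLocal] at hl
  | areadReturn =>
    have hp : (c (t + 1)).proc j = { (c t).proc j with
        y := scanResult ((c t).proc j).A ((c t).proc j).B, pc := .test, phase := .ready } := by
      generalize hc' : c (t + 1) = c' at hk
      cases hk <;> simp_all [readTarget, writeTarget, Config.setProc, afterLocal]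
    unfold ScanInv at h ⊢
    rw [hp]; simp only [hpc] at h ⊢
    intro y hy
    refine h.imp (fun h => ?_) fun h => h.trans hcm
    rcases h with ⟨m, -, h⟩ | ⟨m, -, h⟩
    · rw [(scanResult_eq_some hy m).1] at h; exact h.succ
    · rw [(scanResult_eq_some hy m).2] at h; exact h.succ
  | test =>
    exfalso
    generalize hc' : c (t + 1) = c' at hk
    cases hk with
    | localStep hl =>
      rcases afterTest_cases j ((c t).proc j) with ⟨y, -, -, hne, e⟩ | ⟨-, -, e⟩ | ⟨-, e⟩ <;>
      simp [hc', Config.setProc, afterLocal, hpc, e, Pc.IsScanning] at hsc'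
    | _ => simp_all [readTarget, writeTarget]
  | _ => simp [hpc, Pc.IsScanning] at hsc

theorem CleanRun.scan_start (hr : CleanRun c) (hφ : 0 < φ)
    (h : ¬ ((c t).proc j).pc.IsScanning) (h' : ((c (t + 1)).proc j).pc.IsScanning) :
    ((c (t + 1)).proc j).pc = .scan ⟨0, hφ⟩ .a ∧ ((c (t + 1)).proc j).phase = .ready := by
  obtain ⟨k, hk⟩ := hr.step t
  by_cases hjk : j = k
  swap
  · rw [(hk.local_other hjk).2.2.2] at h'
    exact absurd h' h
  subst hjk
  generalize hc' : c (t + 1) = c' at hk h'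
  cases hk with
  | respondRead ρ ha hrt =>
    cases hpc : ((c t).proc j).pc with
    | readOwn => simp [Config.setProc, afterRead, hpc, scanFrom, hφ]
    | awRead r => cases r <;> simp [Config.setProc, afterRead, hpc, Pc.IsScanning] at h'
    | _ => simp_all [readTarget, Pc.IsScanning]
  | respondReadDisturbed ρ v ha hrt =>
    cases hpc : ((c t).proc j).pc with
    | readOwn => simp [Config.setProc, afterRead, hpc, scanFrom, hφ]
    | awRead r => cases r <;> simp [Config.setProc, afterRead, hpc, Pc.IsScanning] at h'
    | _ => simp_all [readTarget, Pc.IsScanning]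
  | localStep hl =>
    cases hpc : ((c t).proc j).pc with
    | awTest =>
      simp only [Config.setProc, afterLocal, hpc, Function.update_self] at h'
      split_ifs at h' <;> simp [Pc.IsScanning] at h'
    | _ => simp_all [Pc.IsScanning, Pc.IsLocal, Config.setProc, afterLocal]
  | respondWrite ρ hrd hwt =>
    cases hpc : ((c t).proc j).pc with
    | awWrite r => cases r <;> simp [afterWrite, hpc, Pc.IsScanning] at h'
    | _ => simp_all [writeTarget]
  | _ => simp_all [Config.setProc]

/-- A scan in progress at time 0 has arrays of unknown content. The hypothesis `1 ≤ issued c j t`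
excludes it, since a scanning processor has no pending value and so has issued nothing at time 0. -/
theorem CleanRun.scanInv (hr : CleanRun c) (hK : 1 < K) (hφ : 0 < φ) (hw : w = prev j) (t : ℕ)
    (h1 : 1 ≤ issued c j t) (h2 : ((c t).proc j).pc.IsScanning) :
    ∃ s ≤ t, issued c j s = issued c j t ∧ ¬ Pend j (c s) ∧ ScanInv c w j s t := by
  induction t with
  | zero =>
    rw [issued_of_not_pend (not_pend_of_isScanning h2)] at h1
    simp [commits] at h1
  | succ t ih =>
    by_cases h3 : ((c t).proc j).pc.IsScanning
    · have hf : ¬ FireAt c j t := fun hf => by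
        rw [hf.2] at h2; exact h2
      rw [hr.issued_succ_of_not_fire hf] at h1 ⊢
      obtain ⟨s, hs, h4, h5, h6⟩ := ih h1 h3
      refine ⟨s, hs.trans (Nat.le_succ t), h4, h5, ?_⟩
      obtain ⟨k, hk⟩ := hr.step t
      by_cases hjk : j = k
      · subst hjk
        exact h6.own hr hK hw hs hk h3 h2
      · exact h6.other hr hK hw hk hjk
    · obtain ⟨h4, h5⟩ := hr.scan_start hφ h3 h2
      refine ⟨t + 1, le_rfl, rfl, not_pend_of_isScanning h2, ?_⟩
      unfold ScanInv
      rw [h4]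
      simp [h5]

/-- The value `y` accepted by a firing has been offered by the predecessor since the previous
firing, unless the predecessor has committed `φ` times since then. -/
theorem CleanRun.fire_offered (hr : CleanRun c) (hK : 1 < K) (hφ : 0 < φ)
    (hf : FireAt c j t) (h1 : 1 ≤ issued c j t) {y : Fin K} (hy : ((c t).proc j).y = some y) :
    ∃ s ≤ t, issued c j s = issued c j t ∧ ¬ Pend j (c s) ∧
      (Offered c (prev j) s t y ∨ commits c (prev j) s + φ ≤ commits c (prev j) t) := by
  obtain ⟨s, hs, h2, h3, h4⟩ := hr.scanInv hK hφ rfl t h1 (by rw [hf.1]; trivial)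
  refine ⟨s, hs, h2, h3, ?_⟩
  unfold ScanInv at h4
  rw [hf.1] at h4
  exact h4 y hy

end

/-! ### Sources: which version of the predecessor a firing copies -/

section

variable {c : ℕ → Config n φ K} {i j : Fin n} {s t : ℕ}

theorem issued_zero_le (c : ℕ → Config n φ K) (i : Fin n) : issued c i 0 ≤ 1 := by
  unfold issued commits
  split_ifs <;> omega

theorem CleanRun.exists_fire_index (hr : CleanRun c) (hK : 1 < K) (i : Fin n) {k : ℕ} (hk : 1 ≤ k)
    (h : k < issued c i t) : ∃ u < t, issued c i u = k ∧ FireAt c i u := by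
  obtain ⟨u, -, h1⟩ := hr.exists_fire hK (Nat.zero_le t) ((issued_zero_le c i).trans hk) h
  exact ⟨u, h1⟩

theorem CleanRun.fire_unique (hr : CleanRun c) (hK : 1 < K) (hs : FireAt c j s) (ht : FireAt c j t)
    (h : issued c j s = issued c j t) : s = t := by
  have h1 := (hr.issued_succ_of_fire hK hs).1
  have h2 := (hr.issued_succ_of_fire hK ht).1
  rcases lt_trichotomy s t with h3 | h3 | h3
  · have := hr.issued_mono hK j (Nat.succ_le_of_lt h3)
    simp only [Nat.succ_eq_add_one] at this; omega
  · exact h3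
  · have := hr.issued_mono hK j (Nat.succ_le_of_lt h3)
    simp only [Nat.succ_eq_add_one] at this; omega

/-- `κ f` is the version of the predecessor's value that `p_j` took over as its `f`-th value,
provided that the scan was not overrun by `φ` commits. -/
theorem CleanRun.exists_source (hr : CleanRun c) (hK : 1 < K) (hφ : 2 ≤ φ) (j : Fin n) :
    ∃ κ : ℕ → ℕ, ∀ t, FireAt c j t → 1 ≤ issued c j t →
      κ (issued c j t + 1) ≤ commits c (prev j) t ∧
      (2 ≤ issued c j t → κ (issued c j t) < κ (issued c j t + 1)) ∧
      ((∀ y, ((c t).proc j).y = some y → val c (prev j) (κ (issued c j t + 1)) = y) ∨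
        ∃ s ≤ t, issued c j s = issued c j t ∧ ¬ Pend j (c s) ∧
          commits c (prev j) s + φ ≤ commits c (prev j) t) := by
  have hex : ∀ f, ∃ k, ∀ t, FireAt c j t → 1 ≤ issued c j t → issued c j t + 1 = f →
      ∃ s ≤ t, issued c j s = issued c j t ∧ ¬ Pend j (c s) ∧
        commits c (prev j) s ≤ k ∧ k ≤ commits c (prev j) t ∧
        ((∀ y, ((c t).proc j).y = some y → val c (prev j) k = y) ∨
          commits c (prev j) s < k ∧ k < commits c (prev j) t ∧
          commits c (prev j) s + φ ≤ commits c (prev j) t) := by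
    intro f
    by_cases h : ∃ t, FireAt c j t ∧ 1 ≤ issued c j t ∧ issued c j t + 1 = f
    · obtain ⟨t, hf, h1, h2⟩ := h
      obtain ⟨-, -, -, y, hy, -⟩ := hr.fire_spec hK hf
      obtain ⟨s, hs, h3, h4, h5⟩ := hr.fire_offered hK (by omega) hf h1 hy
      have huniq : ∀ t', FireAt c j t' → issued c j t' + 1 = f → t' = t := fun t' hf' he =>
        hr.fire_unique hK hf' hf (by omega)
      rcases h5 with ⟨u, hu1, hu2, hu3⟩ | h5
      · refine ⟨commits c (prev j) u, fun t' hf' _ he => ?_⟩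
        obtain rfl := huniq t' hf' he
        refine ⟨s, hs, h3, h4, commits_mono c _ hu1, commits_mono c _ hu2, .inl ?_⟩
        intro y' hy'
        rw [hy] at hy'
        rw [hr.val_commits hK, hu3]
        exact Option.some.inj hy'
      -- After an overrun the value read says nothing. A version strictly between the commit counts
      -- at both ends of the scan exists as `φ ≥ 2`, and cannot coincide with the source of a
      -- neighbouring firing.
      · refine ⟨commits c (prev j) s + 1, fun t' hf' _ he => ?_⟩
        obtain rfl := huniq t' hf' he
        exact ⟨s, hs, h3, h4, Nat.le_succ _, by omega, .inr ⟨by omega, by omega, h5⟩⟩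
    · exact ⟨0, fun t h1 h2 h3 => absurd ⟨t, h1, h2, h3⟩ h⟩
  choose κ hκ using hex
  refine ⟨κ, fun t hf h1 => ?_⟩
  obtain ⟨s, hs, h3, h4, h5, h6, h7⟩ := hκ _ t hf h1 rfl
  refine ⟨h6, fun h2 => ?_, h7.imp id fun h => ⟨s, hs, h3, h4, h.2.2⟩⟩
  obtain ⟨t₁, ht, hi, hf₁⟩ := hr.exists_fire_index (k := issued c j t - 1) hK j (t := t)
    (by omega) (by omega)
  have hi' : issued c j t₁ + 1 = issued c j t := by omega
  obtain ⟨s₁, hs₁, g3, g4, g5, g6, g7⟩ := hκ _ t₁ hf₁ (by omega) hi'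
  have hlt : t₁ ≤ s := by
    by_contra hlt
    have := hr.issued_mono hK j (Nat.le_of_not_le hlt)
    omega
  have hle := commits_mono c (prev j) hlt
  by_contra hge
  -- Equal sources would mean that the same value was read twice in succession. But after copying
  -- `y` a processor other than `p_0` does not fire on `y`, and `p_0`, now holding `y + 1`, does not
  -- either.
  have he : κ (issued c j t + 1) = κ (issued c j t) := by omega
  have h7' := h7.resolve_right (by omega)
  have g7' := g7.resolve_right (by omega)
  obtain ⟨-, -, -, y₁, hy₁, hfs₁⟩ := hr.fire_spec hK hf₁
  obtain ⟨-, -, -, y, hy, hfs⟩ := hr.fire_spec hK hf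
  have hyy : y = y₁ := by rw [← h7' y hy, ← g7' y₁ hy₁, he]
  have hnew : newest j (c (t₁ + 1)) = newest j (c t) :=
    hr.newest_eq_of_issued_eq hK ht (by rw [(hr.issued_succ_of_fire hK hf₁).1, hi'])
  subst hyy
  rcases hfs₁ with ⟨a1, a2, a3⟩ | ⟨a1, a2, a3⟩ <;> rcases hfs with ⟨b1, b2, b3⟩ | ⟨b1, b2, b3⟩
  · exact b2 (hnew.symm.trans a3)
  · exact a1 b1
  · exact b1 a1
  · exact incMod_ne hK y (by rw [← a3, hnew, b2])

/-- The sources increase strictly and cannot exceed the predecessor's commits. The 2 arises because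
value 1 may be pending initially or stem from a scan begun before the run, and value 2 may copy
version 0. Overruns are allowed here; the bound serves to exclude them. -/
theorem CleanRun.issued_le_commits_prev (hr : CleanRun c) (hK : 1 < K) (hφ : 2 ≤ φ) (j : Fin n)
    (t : ℕ) : issued c j t ≤ commits c (prev j) t + 2 := by
  obtain ⟨κ, hκ⟩ := hr.exists_source hK hφ j
  have key : ∀ f, f + 2 ≤ issued c j t → f ≤ κ (f + 2) := by
    intro f
    induction f with
    | zero => intro _; exact Nat.zero_le _
    | succ f ih =>
      intro h
      obtain ⟨u, -, hu, hf⟩ := hr.exists_fire_index (k := f + 2) hK j (t := t) (by omega) (by omega)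
      have := (hκ u hf (by omega)).2.1 (by omega)
      rw [hu] at this
      have := ih (by omega)
      rw [show f + 1 + 2 = f + 2 + 1 from rfl]; omega
  by_contra hlt
  obtain ⟨u, hut, hu, hf⟩ := hr.exists_fire_index (k := issued c j t - 1) hK j (t := t)
    (by omega) (by omega)
  have h1 := (hκ u hf (by omega)).1
  have h2 := key (issued c j t - 2) (by omega)
  have h3 := commits_mono c (prev j) hut.le
  rw [show issued c j u + 1 = issued c j t - 2 + 2 by omega] at h1
  omega

theorem prev_val {i : Fin n} {a : ℕ} (h : i.val = (a + 1) % n) : (prev i).val = a % n := by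
  have hn := i.pos
  have h1 := Nat.mod_lt a hn
  simp only [prev, h]
  rw [Nat.add_mod a 1 n]
  rcases Nat.lt_or_ge (a % n + 1) n with h2 | h2
  · by_cases hn1 : n = 1
    · omega
    · rw [Nat.mod_eq_of_lt (show 1 < n by omega), Nat.mod_eq_of_lt h2,
        show a % n + 1 + n - 1 = a % n + n by omega, Nat.add_mod_right, Nat.mod_mod]
  · by_cases hn1 : n = 1
    · subst hn1; omega
    · rw [Nat.mod_eq_of_lt (show 1 < n by omega), show a % n + 1 = n by omega, Nat.mod_self,
        Nat.zero_add, Nat.mod_eq_of_lt (by omega)]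
      omega

theorem CleanRun.issued_le_add (hr : CleanRun c) (hK : 1 < K) (hφ : 2 ≤ φ) (j : Fin n)
    (t m : ℕ) : ∀ i : Fin n, i.val = (j.val + m) % n → issued c i t ≤ issued c j t + 2 * m := by
  induction m with
  | zero =>
    intro i hi
    rw [Nat.add_zero, Nat.mod_eq_of_lt j.isLt] at hi
    rw [Fin.ext hi]; omega
  | succ m ih =>
    intro i hi
    have h1 := hr.issued_le_commits_prev hK hφ i t
    have h2 := ih (prev i) (prev_val (by rw [hi, Nat.add_assoc]))
    have h3 := commits_le_issued c (prev i) t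
    omega

/-- While `p_j` does not move, its predecessor commits fewer than `φ` times. -/
theorem CleanRun.commits_prev_lt (hr : CleanRun c) (hK : 1 < K) (hφ : 2 * n < φ) (hst : s ≤ t)
    (h : issued c j s = issued c j t) (hp : ¬ Pend j (c s)) :
    commits c (prev j) t < commits c (prev j) s + φ := by
  obtain ⟨d, rfl⟩ := Nat.exists_eq_add_of_le hst
  have hn := j.pos
  -- Counting afresh from time `s`, `p_j` issues nothing. The `n - 1` links from `p_j` forward to
  -- its predecessor then allow at most `2 (n - 1)` commits.
  have h0 : issued (tailFrom c s) j d = 0 := by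
    have h1 := commits_tailFrom c j s d
    rw [issued_of_not_pend hp] at h
    unfold issued at h ⊢
    have : tailFrom c s d = c (s + d) := rfl
    rw [this]
    omega
  have h1 := (hr.tail s).issued_le_add hK (by omega) j d (n - 1) (prev j) (by
    simp only [prev]; congr 1; omega)
  have h2 := commits_le_issued (tailFrom c s) (prev j) d
  rw [commits_tailFrom]
  omega

/-- Firing number `f` of `p_j` copies the version `κ j f` of its predecessor. -/
structure IsSource (c : ℕ → Config n φ K) (κ : Fin n → ℕ → ℕ) : Prop where
  le : ∀ {j t}, FireAt c j t → 1 ≤ issued c j t → κ j (issued c j t + 1) ≤ commits c (prev j) t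
  lt : ∀ {j t}, FireAt c j t → 2 ≤ issued c j t → κ j (issued c j t) < κ j (issued c j t + 1)
  val : ∀ {j t y}, FireAt c j t → 1 ≤ issued c j t → ((c t).proc j).y = some y →
    val c (prev j) (κ j (issued c j t + 1)) = y

theorem CleanRun.exists_isSource (hr : CleanRun c) (hK : 1 < K) (hφ : 2 * n < φ) (hn : 0 < n) :
    ∃ κ, IsSource c κ := by
  choose κ hκ using fun j => hr.exists_source hK (by omega : 2 ≤ φ) j
  refine ⟨κ, fun {j t} hf h1 => (hκ j t hf h1).1, fun {j t} hf h1 => (hκ j t hf (by omega)).2.1 h1,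
    fun {j t y} hf h1 hy => ((hκ j t hf h1).2.2.resolve_right ?_) y hy⟩
  rintro ⟨s, hs, h2, h3, h4⟩
  have := hr.commits_prev_lt hK hφ hs h2 h3
  omega

theorem IsSource.add_le {κ : Fin n → ℕ → ℕ} (hκ : IsSource c κ) (hr : CleanRun c) (hK : 1 < K)
    {a d : ℕ} (ha : 2 ≤ a) (h : a + d ≤ issued c j t) : κ j a + d ≤ κ j (a + d) := by
  induction d with
  | zero => rfl
  | succ d ih =>
    obtain ⟨u, -, hu, hf⟩ := hr.exists_fire_index (k := a + d) hK j (t := t) (by omega) (by omega)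
    have := hκ.lt hf (by omega)
    rw [hu] at this
    have := ih (by omega)
    rw [← Nat.add_assoc, ← Nat.add_assoc]; omega

/-- The values of `p_0` are counted up modulo `K`. -/
theorem CleanRun.val_zero_add (hr : CleanRun c) (hK : 1 < K) (hj : j.val = 0) {a d : ℕ}
    (ha : 1 ≤ a) (h : a + d ≤ issued c j t) :
    (val c j (a + d)).val = ((val c j a).val + d) % K := by
  induction d with
  | zero => rw [Nat.add_zero, Nat.add_zero, Nat.mod_eq_of_lt (val c j a).isLt]
  | succ d ih =>
    obtain ⟨u, -, hu, hf⟩ := hr.exists_fire_index (k := a + d) hK j (t := t) (by omega) (by omega)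
    obtain ⟨-, -, -, y, -, hy⟩ := hr.fire_spec hK hf
    rcases hy with ⟨h1, -⟩ | ⟨-, h2, h3⟩
    · exact absurd hj h1
    · have h4 : val c j (a + (d + 1)) = incMod (val c j (a + d)) := by
        rw [← Nat.add_assoc, ← hu, hr.val_issued hK, h2, ← h3,
          ← (hr.issued_succ_of_fire hK hf).1, hr.val_issued hK]
      rw [h4]
      simp only [incMod]
      rw [ih (by omega), ← Nat.add_assoc, Nat.mod_add_mod]

end

/-! ### Synchronization, and the single token that follows from it -/

/-- `p_0` fires on reading the value it holds itself, the others on reading a new one. -/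
def lead (i : Fin n) : ℕ := if i.val = 0 then 1 else 0

section

variable {c : ℕ → Config n φ K} {i j : Fin n} {s t T : ℕ}

theorem commits_succ_le_issued (c : ℕ → Config n φ K) (i : Fin n) (t : ℕ) :
    commits c i (t + 1) ≤ issued c i t := by
  unfold issued
  rw [commits]
  split_ifs <;> simp_all

/-- At time `T`, processor `p_i` has just passed on its value number `k i`, and these are copies of
each other. -/
structure Synced (c : ℕ → Config n φ K) (κ : Fin n → ℕ → ℕ) (T : ℕ) (k : Fin n → ℕ) : Prop where
  two_le : ∀ i, 2 ≤ k i
  issued_eq : ∀ i, issued c i T = k i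
  commits_eq : ∀ i, commits c i T = k i
  source : ∀ i, κ i (k i + lead i) = k (prev i)

theorem CleanRun.exists_synced (hr : CleanRun c) (hK : 2 * n < K) {κ : Fin n → ℕ → ℕ}
    (hκ : IsSource c κ) {z : Fin n} (hz : z.val = 0) (hf : FireAt c z T)
    (hm : 2 * n < issued c z T) : ∃ k, Synced c κ T k := by
  have hn := z.pos
  have hK1 : 1 < K := by omega
  set m := issued c z T with hm_def
  obtain ⟨hnp, -, -, y, hy, hyz⟩ := hr.fire_spec hK1 hf
  replace hyz : newest z (c T) = y := hyz.elim (fun h => absurd hz h.1) fun h => h.2.1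
  have hcz : commits c z T = m := (issued_of_not_pend hnp).symm
  let p : ℕ → Fin n := fun d => ⟨n - 1 - d, by omega⟩
  have hp0 : p 0 = prev z := by
    apply Fin.ext
    simp only [p, prev, hz]
    rw [Nat.mod_eq_of_lt (by omega)]; omega
  have hps : ∀ d, d + 1 < n → p (d + 1) = prev (p d) := by
    intro d hd
    apply Fin.ext
    simp only [p, prev]
    rw [show n - 1 - d + n - 1 = n - 1 - (d + 1) + n by omega, Nat.add_mod_right,
      Nat.mod_eq_of_lt (by omega)]
  have hpz : p (n - 1) = z := Fin.ext (by simp [p, hz])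
  -- The value `y` that makes `p_0` fire is traced backwards through `p_{n-1}, …, p_0`; `g d` is the
  -- number of its version at `p d`.
  let g : ℕ → ℕ := fun d => Nat.rec (κ z (m + 1)) (fun d r => κ (p d) r) d
  have hg0 : g 0 = κ z (m + 1) := rfl
  have hgs : ∀ d, g (d + 1) = κ (p d) (g d) := fun d => rfl
  have down : ∀ d, d < n → g d ≤ commits c (p d) T ∧ m + 1 ≤ g d + 2 * (d + 1) ∧
      val c (p d) (g d) = y := by
    intro d
    induction d with
    | zero =>
      intro _
      have h1 := hκ.add_le (j := z) (t := T) hr hK1 (a := 2) (d := m - 2) le_rfl (by omega)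
      have h2 : κ z m < κ z (m + 1) := hκ.lt hf (by omega)
      rw [show 2 + (m - 2) = m by omega] at h1
      rw [hg0, hp0]
      exact ⟨hκ.le hf (by omega), by omega, hκ.val hf (by omega) hy⟩
    | succ d ih =>
      intro hd
      obtain ⟨h1, h2, h3⟩ := ih (by omega)
      have hle := commits_le_issued c (p d) T
      have hne : (p d).val ≠ 0 := by simp only [p]; omega
      obtain ⟨u, huT, hu, hfu⟩ := hr.exists_fire_index (k := g d - 1) hK1 (p d) (t := T)
        (by omega) (by omega)
      have hu1 : issued c (p d) u + 1 = g d := by omega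
      obtain ⟨-, -, -, y', hy', hyu⟩ := hr.fire_spec hK1 hfu
      replace hyu : newest (p d) (c (u + 1)) = y' :=
        hyu.elim (fun h => h.2.2) fun h => absurd h.1 hne
      rw [← hr.val_issued hK1, (hr.issued_succ_of_fire hK1 hfu).1, hu1, h3] at hyu
      rw [hgs, hps d hd]
      have h4 := hκ.le hfu (by omega)
      have h5 := hκ.val hfu (by omega) hy'
      have h6 := hκ.add_le (j := p d) (t := T) hr hK1 (a := 2) (d := g d - 2) le_rfl (by omega)
      rw [hu1] at h4 h5
      rw [show 2 + (g d - 2) = g d by omega] at h6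
      exact ⟨h4.trans (commits_mono c _ huT.le), by omega, by rw [h5, hyu]⟩
  -- The trace ends at a version of `p_0` with value `y`, at most `2 n - 1` numbers before `m`.
  -- Since `p_0` counts modulo `K > 2 n` and its version `m` is also `y`, the two versions coincide.
  have hgz : g (n - 1) = m := by
    obtain ⟨h1, h2, h3⟩ := down (n - 1) (by omega)
    rw [hpz] at h1 h3
    rw [hcz] at h1
    have h4 := hr.val_zero_add (j := z) (t := T) hK1 hz (a := g (n - 1)) (d := m - g (n - 1))
      (by omega) (by omega)
    rw [show g (n - 1) + (m - g (n - 1)) = m by omega, hm_def, hr.val_issued hK1, hyz,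
      h3] at h4
    have h5 := y.isLt
    rcases Nat.lt_or_ge (y.val + (m - g (n - 1))) K with h6 | h6
    · rw [Nat.mod_eq_of_lt h6] at h4; omega
    · rw [Nat.mod_eq_sub_mod h6, Nat.mod_eq_of_lt (by omega)] at h4; omega
  -- From `p_0` onwards in ring order: a value beyond the trace would need a source beyond the trace
  -- at the predecessor, which has not gone further.
  have up : ∀ e, e < n → issued c (p (n - 1 - e)) T ≤ g (n - 1 - e) := by
    intro e
    induction e with
    | zero => intro _; rw [Nat.sub_zero, hpz, hgz]
    | succ e ih =>
      intro he
      have h1 := ih (by omega)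
      generalize hd : n - 1 - (e + 1) = d
      rw [show n - 1 - e = d + 1 by omega, hps d (by omega), hgs] at h1
      by_contra hlt
      have h2 := (down d (by omega)).2.1
      obtain ⟨u, huT, hu, hfu⟩ := hr.exists_fire_index (k := g d) hK1 (p d) (t := T)
        (by omega) (by omega)
      have h3 := hκ.lt hfu (by omega)
      have h4 := hκ.le hfu (by omega)
      have h5 := commits_mono c (prev (p d)) huT.le
      have h6 := commits_le_issued c (prev (p d)) T
      rw [hu] at h3 h4
      omega
  have hpi : ∀ i : Fin n, p (n - 1 - i.val) = i := fun i =>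
    Fin.ext (by simp only [p]; omega)
  have hiss : ∀ i : Fin n, issued c i T = g (n - 1 - i.val) ∧
      commits c i T = g (n - 1 - i.val) := by
    intro i
    have h1 := up i.val i.isLt
    have h2 := (down (n - 1 - i.val) (by omega)).1
    rw [hpi] at h1 h2
    have h3 := commits_le_issued c i T
    omega
  refine ⟨fun i => g (n - 1 - i.val), fun i => ?_, fun i => (hiss i).1, fun i => (hiss i).2,
    fun i => ?_⟩
  · have := (down (n - 1 - i.val) (by omega)).2.1
    show 2 ≤ g (n - 1 - i.val)
    omega
  · by_cases hi : i.val = 0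
    · obtain rfl : i = z := Fin.ext (by rw [hi, hz])
      have : n - 1 - (prev i).val = 0 := by rw [← hp0]; simp only [p]; omega
      simp only [lead, hi, if_true, this, Nat.sub_zero, hgz, hg0]
    · have h1 : n - 1 - (prev i).val = n - 1 - i.val + 1 := by
        have := hps (n - 1 - i.val) (by omega)
        rw [hpi] at this
        rw [← this]; simp only [p]; omega
      simp only [lead, hi, if_false, Nat.add_zero, h1, hgs, hpi]

/-- Counted from `T`, no processor issues more than its predecessor commits, because sources
increase strictly; `p_0` alone may issue one more, having already been offered the value it needs.
-/
theorem Synced.slack {κ : Fin n → ℕ → ℕ} {k : Fin n → ℕ} (hS : Synced c κ T k)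
    (hκ : IsSource c κ) (hr : CleanRun c) (hK : 1 < K) (ht : T ≤ t) (j : Fin n) :
    issued c j t + k (prev j) ≤ commits c (prev j) t + k j + lead j := by
  induction t, ht using Nat.le_induction with
  | base => rw [hS.issued_eq, hS.commits_eq]; omega
  | succ t ht ih =>
    have h1 := commits_mono c (prev j) (Nat.le_succ t)
    simp only [Nat.succ_eq_add_one] at h1
    by_cases hf : FireAt c j t
    · have h2 := (hr.issued_succ_of_fire hK hf).1
      have h3 := hr.issued_mono hK j ht
      rw [hS.issued_eq] at h3
      have h4 := hS.two_le j
      have h5 := hκ.le hf (by omega)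
      have h6 : lead j ≤ 1 := by unfold lead; split_ifs <;> omega
      have h7 := hκ.add_le (j := j) (t := t + 1) hr hK (a := k j + lead j)
        (d := issued c j t + 1 - (k j + lead j)) (by omega) (by omega)
      rw [hS.source, show k j + lead j + (issued c j t + 1 - (k j + lead j)) =
        issued c j t + 1 by omega] at h7
      omega
    · rw [hr.issued_succ_of_not_fire hf]; omega

theorem prev_next (i : Fin n) : prev (next i) = i := by
  apply Fin.ext
  rw [prev_val (a := i.val) rfl, Nat.mod_eq_of_lt i.isLt]

theorem prev_bijective : Function.Bijective (prev : Fin n → Fin n) :=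
  Finite.injective_iff_bijective.1 (Finite.injective_iff_surjective.2 fun i => ⟨next i, prev_next i⟩)

theorem eq_next_of_prev_eq {i j : Fin n} (h : prev j = i) : j = next i :=
  prev_bijective.1 (h.trans (prev_next i).symm)

theorem sum_lead (hn : 0 < n) : ∑ i : Fin n, lead i = 1 := by
  rw [Finset.sum_eq_single (⟨0, hn⟩ : Fin n)]
  · simp [lead]
  · intro i _ hi
    have : i.val ≠ 0 := fun h => hi (Fin.ext h)
    simp [lead, this]
  · simp

/-- If some processor has a pending value, no other one has, and no processor is about to fire. -/
theorem Synced.of_pend {κ : Fin n → ℕ → ℕ} {k : Fin n → ℕ} (hS : Synced c κ T k)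
    (hκ : IsSource c κ) (hr : CleanRun c) (hK : 1 < K) (ht : T ≤ t) (hp : Pend i (c t)) :
    (∀ j, Pend j (c t) → j = i) ∧
      ∀ j, issued c j t + k (prev j) = commits c (prev j) t + k j + lead j := by
  classical
  let q : Fin n → ℕ := fun j => if Pend j (c t) then 1 else 0
  have hq : ∀ j, issued c j t = commits c j t + q j := fun j => rfl
  have hn := i.pos
  have hsl := fun j => hS.slack hκ hr hK ht j
  -- Let `d j` be the slack of the link into `p_j`. Summed around the ring, commits and offsets `k`
  -- cancel, leaving total slack plus number of pending values equal to 1.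
  choose d hd using fun j => Nat.exists_eq_add_of_le (hsl j)
  have hsum : ∑ j, (commits c (prev j) t + k j + lead j) =
      ∑ j, (issued c j t + k (prev j) + d j) := Finset.sum_congr rfl fun j _ => hd j
  simp only [hq, Finset.sum_add_distrib] at hsum
  rw [prev_bijective.sum_comp (fun j => commits c j t), prev_bijective.sum_comp k,
    sum_lead hn] at hsum
  have hqi : q i = 1 := if_pos hp
  have hle : q i ≤ ∑ j, q j := Finset.single_le_sum (fun _ _ => Nat.zero_le _) (Finset.mem_univ i)
  refine ⟨fun j hj => ?_, fun j => ?_⟩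
  · by_contra hji
    have hqj : q j = 1 := if_pos hj
    have : ∑ x ∈ {i, j}, q x ≤ ∑ x, q x := Finset.sum_le_univ_sum_of_nonneg fun _ => Nat.zero_le _
    rw [Finset.sum_pair (Ne.symm hji)] at this
    omega
  · have h1 : d j ≤ ∑ j, d j := Finset.single_le_sum (fun _ _ => Nat.zero_le _) (Finset.mem_univ j)
    have := hd j
    omega

/-- From a synchronized configuration on, the critical section is visited in ring order. -/
theorem Synced.mutualExclusion {κ : Fin n → ℕ → ℕ} {k : Fin n → ℕ} (hS : Synced c κ T k)
    (hκ : IsSource c κ) (hr : CleanRun c) (hK : 1 < K)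
    (hlive : ∀ i t, ∃ u, t ≤ u ∧ InCrit (c u) i) (hT : T ≤ s) :
    MutualExclusion (tailFrom c s) := by
  have huniq : ∀ t i j, T ≤ t → InCrit (c t) i → InCrit (c t) j → i = j := fun t i j ht hi hj =>
    (hS.of_pend hκ hr hK ht ((hr.clean t j).pend_of_inCrit hj)).1 i
      ((hr.clean t i).pend_of_inCrit hi)
  refine ⟨fun t i j => huniq _ i j (by omega), fun i t => ?_, ?_⟩
  · obtain ⟨u, hu, h⟩ := hlive i (s + t)
    obtain ⟨d, rfl⟩ := Nat.exists_eq_add_of_le hu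
    exact ⟨t + d, by omega, by unfold tailFrom; rw [← Nat.add_assoc]; exact h⟩
  · intro a b i j hab hi hi' hj hno
    have hnc : ∀ u, s + a < u → u < s + b → ∀ x, ¬ InCrit (c u) x := fun u h1 h2 => by
      have := hno (u - s) (by omega) (by omega)
      rwa [tailFrom, Nat.add_sub_of_le (by omega)] at this
    obtain ⟨d, rfl⟩ := Nat.exists_eq_add_of_lt hab
    have hj' : ¬ InCrit (c (s + (a + d))) j := by
      intro h
      rcases Nat.eq_zero_or_pos d with rfl | hd
      · obtain rfl := huniq _ _ _ (by omega) hi h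
        exact hi' hj
      · exact hnc _ (by omega) (by omega) j h
    have hfj : FireAt c j (s + (a + d)) := by
      obtain ⟨x, hx⟩ := hr.step (s + (a + d))
      exact hx.fire_of_enter hj' hj
    have hconst : ∀ x, issued c x (s + (a + d)) ≤ issued c x (s + a) := by
      intro x
      by_contra hlt
      obtain ⟨u, h1, h2, -, h3⟩ := hr.exists_fire hK (by omega) le_rfl (Nat.lt_of_not_le hlt)
      exact hnc (u + 1) (by omega) (by omega) x h3.2
    obtain ⟨hother, heq⟩ :=
      hS.of_pend hκ hr hK (t := s + a) (by omega) ((hr.clean _ i).pend_of_inCrit hi)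
    apply eq_next_of_prev_eq
    -- Otherwise the predecessor of `p_j` has nothing pending and does not fire in between, hence
    -- commits nothing; but the link into `p_j` had no slack left, so `p_j` could not fire.
    by_contra hne
    have h1 := issued_of_not_pend (c := c) (t := s + a) fun h => hne (hother (prev j) h)
    have h2 := hS.slack hκ hr hK (t := s + (a + d) + 1) (by omega) j
    rw [(hr.issued_succ_of_fire hK hfj).1] at h2
    have h3 := heq j
    have h4 := hconst (prev j)
    have h5 := commits_succ_le_issued c (prev j) (s + (a + d))
    have h6 := hr.issued_mono hK j (show s + a ≤ s + (a + d) by omega)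
    omega

end

/-! ### Progress within a round, and convergence to the local invariant -/

/-- The number of program counters still to be passed in the current round. -/
def Pc.toGo : Pc φ → ℕ
  | .readOwn => 2 * φ + 9
  | .scan j .a => 2 * (φ - j) + 7
  | .scan j .b => 2 * (φ - j) + 6
  | .areadReturn => 7
  | .test => 6
  | .crit => 5
  | .awRead .a => 4
  | .awRead .b => 3
  | .awTest => 2
  | .awWrite .a => 1
  | .awWrite .b => 0

/-- A bound for the number of steps still to be made in the current round. -/
def Proc.rank (s : Proc φ K) : ℕ := 2 * s.pc.toGo + if s.phase = .ready then 1 else 0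

section

variable {c c' : Config n φ K} {i k : Fin n}

theorem toGo_scanFrom_succ_lt (m : Fin φ) :
    (scanFrom φ (m.val + 1)).toGo < (Pc.scan m .b : Pc φ).toGo := by
  unfold scanFrom
  have := m.isLt
  split_ifs <;> simp only [Pc.toGo] <;> omega

theorem toGo_scanFrom_zero_lt : (scanFrom φ 0).toGo < (Pc.readOwn : Pc φ).toGo := by
  unfold scanFrom
  split_ifs <;> simp only [Pc.toGo] <;> omega

theorem Step.rank_other (h : Step k c c') (hik : i ≠ k) :
    (c'.proc i).pc = (c.proc i).pc ∧ (c'.proc i).rank = (c.proc i).rank := by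
  rcases h.proc_other hik with hp | ⟨r, -, hph, -, -, -, hp⟩
  · simp [hp]
  · simp [hp, Proc.rank, hph]

theorem rank_lt_of_toGo_lt {s s' : Proc φ K} (h : s'.pc.toGo < s.pc.toGo) : s'.rank < s.rank := by
  unfold Proc.rank
  split_ifs <;> omega

theorem toGo_afterRead_lt {s : Proc φ K} {v : Fin K} {ρ : RegName n}
    (h : readTarget i s.pc = some ρ) : (afterRead s v).pc.toGo < s.pc.toGo := by
  cases hpc : s.pc with
  | readOwn => simpa [afterRead, hpc] using toGo_scanFrom_zero_lt
  | scan m r =>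
    cases r with
    | a => simp [afterRead, hpc, Pc.toGo]
    | b => simpa [afterRead, hpc] using toGo_scanFrom_succ_lt m
  | awRead r => cases r <;> simp [afterRead, hpc, Pc.toGo]
  | _ => simp [readTarget, hpc] at h

/-- Every step of a processor brings it closer to the end of its round, or ends the round. -/
theorem Step.rank_own (h : Step i c c') : (c'.proc i).rank < (c.proc i).rank ∨
    (c'.proc i).pc = .readOwn ∧ (c.proc i).pc.toGo ≤ 2 := by
  cases h with
  | invokeRead ρ hr hrt hq => left; simp [Config.setProc, Proc.rank, hr]
  | invokeReadDisturbed ρ hr hrt hq => left; simp [Config.setProc, Proc.rank, hr]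
  | respondRead ρ ha hrt =>
    left
    simp only [Config.setProc, Function.update_self]
    exact rank_lt_of_toGo_lt (toGo_afterRead_lt hrt)
  | respondReadDisturbed ρ v ha hrt =>
    left
    simp only [Config.setProc, Function.update_self]
    exact rank_lt_of_toGo_lt (toGo_afterRead_lt hrt)
  | invokeWrite ρ hr hw => left; simp [Config.setProc, Proc.rank, hr]
  | respondWrite ρ hr hw =>
    obtain ⟨j, r⟩ := ρ
    obtain ⟨rfl, hpc⟩ := writeTarget_eq_some hw
    cases r with
    | a =>
      left
      apply rank_lt_of_toGo_lt
      simp [afterWrite, hpc, Pc.toGo]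
    | b => right; simp [afterWrite, hpc, Pc.toGo]
  | localStep hl =>
    cases hpc : (c.proc i).pc with
    | areadReturn =>
      left
      apply rank_lt_of_toGo_lt
      simp [Config.setProc, afterLocal, hpc, Pc.toGo]
    | crit =>
      left
      apply rank_lt_of_toGo_lt
      simp [Config.setProc, afterLocal, hpc, Pc.toGo]
    | awTest =>
      by_cases hx : (c.proc i).wA = (c.proc i).x ∧ (c.proc i).wB = (c.proc i).x
      · right
        simp [Config.setProc, afterLocal, hpc, hx, Pc.toGo]
      · left
        apply rank_lt_of_toGo_lt
        simp [Config.setProc, afterLocal, hpc, hx, Pc.toGo]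
    | test =>
      left
      apply rank_lt_of_toGo_lt
      rcases afterTest_cases i (c.proc i) with ⟨y, -, -, -, e⟩ | ⟨-, -, e⟩ | ⟨-, e⟩ <;>
      simp [Config.setProc, afterLocal, hpc, e, Pc.toGo]
    | _ => simp [hpc, Pc.IsLocal] at hl

/-- State of `p_i` in an `AWrite` that it has begun regularly. -/
def Settling (i : Fin n) (c : Config n φ K) : Prop :=
  match (c.proc i).pc with
  | .awRead .a => (c.proc i).phase ≠ .disturbed
  | .awRead .b => (c.proc i).phase ≠ .disturbed ∧ (c.proc i).wA = c.reg (i, .a)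
  | .awTest => (c.proc i).wA = c.reg (i, .a) ∧ (c.proc i).wB = c.reg (i, .b)
  | .awWrite .a => True
  | .awWrite .b => (c.proc i).x = c.reg (i, .a)
  | _ => False

theorem Settling.own (hc : Settling i c) (h : Step i c c') : Settling i c' ∨ Clean i c' := by
  cases hpc : (c.proc i).pc with
  | awRead r =>
    simp only [Settling, hpc] at hc
    cases h with
    | invokeRead ρ hr hrt hq => left; cases r <;> simp_all [Settling, Config.setProc]
    | invokeReadDisturbed ρ hr hrt hq =>
      simp only [hpc, readTarget, Option.some.injEq] at hrt
      rw [← hrt, beingWritten_iff, hpc] at hq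
      simp at hq
    | respondRead ρ ha hrt =>
      simp only [hpc, readTarget, Option.some.injEq] at hrt
      left; cases r <;> simp_all [Settling, Config.setProc, afterRead, ← hrt]
    | respondReadDisturbed ρ v ha hrt => cases r <;> simp_all
    | _ => simp_all [writeTarget, Pc.IsLocal]
  | awTest =>
    simp only [Settling, hpc] at hc
    cases h with
    | localStep hl =>
      by_cases hx : (c.proc i).wA = (c.proc i).x ∧ (c.proc i).wB = (c.proc i).x
      · right
        simp [Clean, Config.setProc, afterLocal, hpc, hx, ← hc.1, ← hc.2]
      · left
        simp [Settling, Config.setProc, afterLocal, hpc, hx]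
    | _ => simp_all [readTarget, writeTarget]
  | awWrite r =>
    simp only [Settling, hpc] at hc
    cases h with
    | invokeWrite ρ hr hw =>
      left; cases r <;> simp_all [Settling, Config.setProc, Config.disturb]
    | respondWrite ρ hr hw =>
      simp only [hpc, writeTarget, Option.some.injEq] at hw
      subst hw
      cases r with
      | a => left; simp [Settling, afterWrite, hpc]
      | b => right; simp_all [Clean, afterWrite]
    | _ => simp_all [readTarget, Pc.IsLocal]
  | _ => simp [Settling, hpc] at hc

theorem Settling.step (hc : Settling i c) (h : Step k c c') : Settling i c' ∨ Clean i c' := by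
  by_cases hik : i = k
  · subst hik; exact hc.own h
  · left
    have hr := h.reg_other hik
    rcases h.proc_other hik with hp | ⟨r, hrt, hph, -, -, -, hp⟩
    · simpa [Settling, hp, hr] using hc
    · cases hpc : (c.proc i).pc with
      | awRead r =>
        simp only [hpc, readTarget, Option.some.injEq] at hrt
        exact absurd (congrArg Prod.fst hrt) hik
      | awTest => simp [hpc, readTarget] at hrt
      | awWrite r => simp [hpc, readTarget] at hrt
      | _ => simp [Settling, hpc] at hc

theorem le_toGo_afterRead {s : Proc φ K} (v : Fin K) {ρ : RegName n}
    (h : readTarget i s.pc = some ρ) (h1 : 5 ≤ s.pc.toGo) : 7 ≤ (afterRead s v).pc.toGo := by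
  have hsf : ∀ m, 7 ≤ (scanFrom φ m).toGo := fun m => by
    unfold scanFrom
    split_ifs <;> simp only [Pc.toGo] <;> omega
  cases hpc : s.pc with
  | readOwn => simpa [afterRead, hpc] using hsf 0
  | scan m r =>
    cases r with
    | a => simp only [afterRead, hpc, Pc.toGo]; omega
    | b => simpa [afterRead, hpc] using hsf (m + 1)
  | awRead r => cases r <;> simp [hpc, Pc.toGo] at h1
  | _ => simp [readTarget, hpc] at h

/-- The threshold 5 is crossed only by entering `AWrite` at its first read, not yet invoked, so
nothing of an arbitrary initial operation survives. -/
theorem Step.settling_of_toGo (h : Step k c c') (h1 : 5 ≤ (c.proc i).pc.toGo)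
    (h2 : (c'.proc i).pc.toGo < 5) : Settling i c' := by
  by_cases hik : i = k
  swap
  · rw [(h.rank_other hik).1] at h2; omega
  subst hik
  cases h with
  | invokeRead ρ hr hrt hq => simp [Config.setProc] at h2; omega
  | invokeReadDisturbed ρ hr hrt hq => simp [Config.setProc] at h2; omega
  | respondRead ρ ha hrt =>
    simp only [Config.setProc, Function.update_self] at h2
    exact absurd (h2.trans (by decide)) (Nat.not_lt.2 (le_toGo_afterRead _ hrt h1))
  | respondReadDisturbed ρ v ha hrt =>
    simp only [Config.setProc, Function.update_self] at h2
    exact absurd (h2.trans (by decide)) (Nat.not_lt.2 (le_toGo_afterRead _ hrt h1))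
  | invokeWrite ρ hr hw => simp [Config.setProc] at h2; omega
  | respondWrite ρ hr hw =>
    obtain ⟨j, r⟩ := ρ
    obtain ⟨-, hpc⟩ := writeTarget_eq_some hw
    cases r <;> simp [hpc, Pc.toGo] at h1
  | localStep hl =>
    cases hpc : (c.proc i).pc with
    | areadReturn => simp [Config.setProc, afterLocal, hpc, Pc.toGo] at h2
    | crit => simp [Settling, Config.setProc, afterLocal, hpc]
    | awTest => simp [hpc, Pc.toGo] at h1
    | test =>
      rcases afterTest_cases i (c.proc i) with ⟨y, -, -, -, e⟩ | ⟨-, -, e⟩ | ⟨-, e⟩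
      · simp [Config.setProc, afterLocal, hpc, e, Pc.toGo] at h2
      · simp [Config.setProc, afterLocal, hpc, e, Pc.toGo] at h2
      · simp [Settling, Config.setProc, afterLocal, hpc, e]
    | _ => simp [hpc, Pc.IsLocal] at hl

theorem Step.test_of_toGo (h : Step i c c') (h1 : 6 ≤ (c.proc i).pc.toGo)
    (h2 : (c'.proc i).pc.toGo < 6) :
    (c.proc i).pc = .test ∧ c'.proc i = afterTest i (c.proc i) := by
  cases h with
  | invokeRead ρ hr hrt hq => simp [Config.setProc] at h2; omega
  | invokeReadDisturbed ρ hr hrt hq => simp [Config.setProc] at h2; omega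
  | respondRead ρ ha hrt =>
    simp only [Config.setProc, Function.update_self] at h2
    exact absurd (h2.trans (by decide)) (Nat.not_lt.2 (le_toGo_afterRead _ hrt (by omega)))
  | respondReadDisturbed ρ v ha hrt =>
    simp only [Config.setProc, Function.update_self] at h2
    exact absurd (h2.trans (by decide)) (Nat.not_lt.2 (le_toGo_afterRead _ hrt (by omega)))
  | invokeWrite ρ hr hw => simp [Config.setProc] at h2; omega
  | respondWrite ρ hr hw =>
    obtain ⟨j, r⟩ := ρ
    obtain ⟨-, hpc⟩ := writeTarget_eq_some hw
    cases r <;> simp [hpc, Pc.toGo] at h1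
  | localStep hl =>
    cases hpc : (c.proc i).pc with
    | areadReturn => simp [Config.setProc, afterLocal, hpc, Pc.toGo] at h2
    | crit => simp [hpc, Pc.toGo] at h1
    | awTest => simp [hpc, Pc.toGo] at h1
    | test => exact ⟨rfl, by simp [Config.setProc, afterLocal, hpc]⟩
    | _ => simp [hpc, Pc.IsLocal] at hl

end

section

variable {c : ℕ → Config n φ K} {i : Fin n}

/-- The next step of `p_i`; its program counter is unchanged before. -/
theorem IsExecution.exists_own_step (hc : IsExecution c) (i : Fin n) (T : ℕ) :
    ∃ t ≥ T, Step i (c t) (c (t + 1)) ∧ ((c t).proc i).pc = ((c T).proc i).pc ∧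
      ((c t).proc i).rank = ((c T).proc i).rank := by
  obtain ⟨sched, hs, hfair⟩ := hc
  classical
  have hex := hfair i T
  obtain ⟨hu, hi⟩ := Nat.find_spec hex
  have key : ∀ t, T ≤ t → t ≤ Nat.find hex → ((c t).proc i).pc = ((c T).proc i).pc ∧
      ((c t).proc i).rank = ((c T).proc i).rank := by
    intro t ht
    induction t, ht using Nat.le_induction with
    | base => intro _; exact ⟨rfl, rfl⟩
    | succ t ht ih =>
      intro htu
      have h1 := ih (by omega)
      have h2 := (hs t).rank_other (i := i) fun e => Nat.find_min hex htu ⟨ht, e.symm⟩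
      exact ⟨h2.1.trans h1.1, h2.2.trans h1.2⟩
  exact ⟨Nat.find hex, hu, by simpa only [hi] using hs (Nat.find hex), key _ hu le_rfl⟩

theorem IsExecution.exists_readOwn (hc : IsExecution c) (i : Fin n) (T : ℕ) :
    ∃ t ≥ T, ((c t).proc i).pc = .readOwn := by
  induction hN : ((c T).proc i).rank using Nat.strong_induction_on generalizing T with
  | _ N ih =>
  obtain ⟨t, ht, hs, -, hrk⟩ := hc.exists_own_step i T
  rcases hs.rank_own with h | ⟨h, -⟩
  · obtain ⟨u, hu, h⟩ := ih _ (by omega) (t + 1) rfl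
    exact ⟨u, by omega, h⟩
  · exact ⟨t + 1, by omega, h⟩

/-- The rank falls at each own step until the round ends, and a round ends only from `toGo ≤ 2`,
hence below `θ`. -/
theorem IsExecution.exists_crossing (hc : IsExecution c) (i : Fin n) {θ : ℕ} (hθ : 2 < θ) (T : ℕ)
    (h0 : θ ≤ ((c T).proc i).pc.toGo) :
    ∃ t ≥ T, Step i (c t) (c (t + 1)) ∧ θ ≤ ((c t).proc i).pc.toGo ∧
      ((c (t + 1)).proc i).pc.toGo < θ := by
  induction hN : ((c T).proc i).rank using Nat.strong_induction_on generalizing T with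
  | _ N ih =>
  obtain ⟨t, ht, hs, hpc, hrk⟩ := hc.exists_own_step i T
  rcases hs.rank_own with h | ⟨-, h⟩
  · by_cases h1 : ((c (t + 1)).proc i).pc.toGo < θ
    · exact ⟨t, ht, hs, by rw [hpc]; exact h0, h1⟩
    · obtain ⟨u, hu, h⟩ := ih _ (by omega) (t + 1) (by omega) rfl
      exact ⟨u, by omega, h⟩
  · rw [hpc] at h; omega

theorem IsExecution.eventually_clean (hc : IsExecution c) (hK : 1 < K) :
    ∃ s, ∀ t ≥ s, ∀ i, Clean i (c t) := by
  obtain ⟨sched, hs, -⟩ := id hc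
  have key : ∀ i, ∀ᶠ t in atTop, Clean i (c t) := by
    intro i
    obtain ⟨t₀, -, h0⟩ := hc.exists_readOwn i 0
    obtain ⟨t₁, -, -, h1, h2⟩ := hc.exists_crossing i (θ := 5) (by omega) t₀
      (by rw [h0]; simp only [Pc.toGo]; omega)
    have h3 : ∀ t ≥ t₁ + 1, Settling i (c t) ∨ Clean i (c t) := by
      intro t ht
      induction t, ht using Nat.le_induction with
      | base => exact .inl ((hs t₁).settling_of_toGo h1 h2)
      | succ t ht ih => exact ih.elim (fun h => h.step (hs t)) fun h => .inr (h.step hK (hs t))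
    obtain ⟨t₂, ht₂, h4⟩ := hc.exists_readOwn i (t₁ + 1)
    have h5 : Clean i (c t₂) := (h3 t₂ ht₂).resolve_left (by simp [Settling, h4])
    refine eventually_atTop.2 ⟨t₂, fun t ht => ?_⟩
    induction t, ht using Nat.le_induction with
    | base => exact h5
    | succ t ht ih => exact ih.step hK (hs t)
  exact eventually_atTop.1 (eventually_all.2 key)

end

/-! ### Absence of deadlock -/

/-- `p_i` is not writing. -/
def NotWriting (i : Fin n) (c : Config n φ K) : Prop := ∀ r, (c.proc i).pc ≠ .awWrite r

/-- Writing starts with `R_a`, and a clean processor at that point has a pending value. -/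
theorem NotWriting.step {i k : Fin n} {c c' : Config n φ K} (hw : NotWriting i c)
    (h : Step k c c') (hc : Clean i c') (hp : ¬ Pend i c') : NotWriting i c' := by
  rintro (_ | _) hpc
  · exact hp (hc.pend_of_writing_a hpc)
  · by_cases hik : i = k
    swap
    · exact hw .b ((h.rank_other hik).1.symm.trans hpc)
    subst hik
    have hw' : ∀ r, (c.proc i).pc ≠ .awWrite r := hw
    cases h with
    | invokeRead ρ hr hrt hq => simp [Config.setProc] at hpc; exact hw _ hpc
    | invokeReadDisturbed ρ hr hrt hq => simp [Config.setProc] at hpc; exact hw _ hpc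
    | respondRead ρ ha hrt =>
      simp only [Config.setProc, Function.update_self, afterRead, scanFrom] at hpc
      split at hpc <;> (try split_ifs at hpc) <;> simp_all
    | respondReadDisturbed ρ v ha hrt =>
      simp only [Config.setProc, Function.update_self, afterRead, scanFrom] at hpc
      split at hpc <;> (try split_ifs at hpc) <;> simp_all
    | invokeWrite ρ hr hwt => exact hw _ (writeTarget_eq_some (r := ρ.2) (i := ρ.1) hwt).2
    | respondWrite ρ hr hwt => exact hw _ (writeTarget_eq_some (r := ρ.2) (i := ρ.1) hwt).2
    | localStep hl =>
      cases hpc' : (c.proc i).pc with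
      | test =>
        rcases afterTest_cases i (c.proc i) with ⟨y, -, -, -, e⟩ | ⟨-, -, e⟩ | ⟨-, e⟩ <;>
          simp [Config.setProc, afterLocal, hpc', e] at hpc
      | awTest =>
        simp only [Config.setProc, afterLocal, hpc', Function.update_self] at hpc
        split_ifs at hpc
        simp at hpc
      | _ => simp_all [Pc.IsLocal, Config.setProc, afterLocal]

/-- All that `p_j` has read so far in its present scan is the value `v`. -/
def ScanEq (j : Fin n) (v : Fin K) (c : Config n φ K) : Prop :=
  match (c.proc j).pc with
  | .scan m .a => (c.proc j).phase ≠ .disturbed ∧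
      (∀ m' < m, (c.proc j).A m' = v) ∧ ∀ m' < m, (c.proc j).B m' = v
  | .scan m .b => (c.proc j).phase ≠ .disturbed ∧
      (∀ m' ≤ m, (c.proc j).A m' = v) ∧ ∀ m' < m, (c.proc j).B m' = v
  | .areadReturn => (∀ m, (c.proc j).A m = v) ∧ ∀ m, (c.proc j).B m = v
  | .test => (c.proc j).y = some v
  | _ => True

theorem scanResult_of_forall (hφ : 0 < φ) {A B : Fin φ → Fin K} {v : Fin K} (hA : ∀ m, A m = v)
    (hB : ∀ m, B m = v) : scanResult A B = some v := by
  simp [scanResult, hφ, hA, hB]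

theorem ScanEq.own {j : Fin n} {v : Fin K} {c c' : Config n φ K} (hφ : 0 < φ)
    (h : ScanEq j v c) (hs : Step j c c') (hw : NotWriting (prev j) c)
    (hreg : ∀ r, c.reg (prev j, r) = v) : ScanEq j v c' := by
  cases hpc : (c.proc j).pc with
  | scan m r =>
    cases hs with
    | invokeRead ρ hr hrt hq => cases r <;> simp_all [ScanEq, Config.setProc]
    | invokeReadDisturbed ρ hr hrt hq =>
      simp only [hpc, readTarget, Option.some.injEq] at hrt
      rw [← hrt, beingWritten_iff] at hq
      exact absurd hq.1 (hw r)
    | respondRead ρ ha hrt =>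
      simp only [hpc, readTarget, Option.some.injEq] at hrt
      subst hrt
      rw [hreg]
      simp only [ScanEq, hpc] at h
      cases r with
      | a =>
        simp only [ScanEq, Config.setProc, afterRead, hpc, Function.update_self]
        refine ⟨by simp, fun m' hm' => ?_, h.2.2⟩
        by_cases he : m' = m
        · simp [he]
        · simp only [Function.update_of_ne he]
          exact h.2.1 m' (lt_of_le_of_ne hm' he)
      | b =>
        have hB : ∀ m' ≤ m, Function.update (c.proc j).B m v m' = v := by
          intro m' hm'
          by_cases he : m' = m
          · simp [he]
          · simp only [Function.update_of_ne he]
            exact h.2.2 m' (lt_of_le_of_ne hm' he)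
        simp only [ScanEq, Config.setProc, afterRead, hpc, Function.update_self, scanFrom]
        by_cases hm : m.val + 1 < φ
        · simp only [hm, dif_pos]
          exact ⟨by simp, fun m' hm' => h.2.1 m' (Nat.lt_succ_iff.1 hm'),
            fun m' hm' => hB m' (Nat.lt_succ_iff.1 hm')⟩
        · simp only [hm, dif_neg, not_false_eq_true]
          have hall : ∀ m' : Fin φ, m' ≤ m := fun m' => by
            have := m'.isLt
            rw [Fin.le_def]; omega
          exact ⟨fun m' => h.2.1 m' (hall m'), fun m' => hB m' (hall m')⟩
    | respondReadDisturbed ρ v ha hrt => cases r <;> simp_all [ScanEq]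
    | _ => simp_all [writeTarget, Pc.IsLocal]
  | areadReturn =>
    simp only [ScanEq, hpc] at h
    have hres := scanResult_of_forall hφ h.1 h.2
    cases hs with
    | localStep hl => simp [ScanEq, Config.setProc, afterLocal, hpc, hres]
    | _ => simp_all [readTarget, writeTarget]
  | readOwn =>
    cases hs with
    | invokeRead ρ hr hrt hq => simp [ScanEq, Config.setProc, hpc]
    | invokeReadDisturbed ρ hr hrt hq => simp [ScanEq, Config.setProc, hpc]
    | respondRead ρ ha hrt =>
      simp [ScanEq, Config.setProc, afterRead, hpc, scanFrom, hφ, Fin.lt_def]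
    | respondReadDisturbed ρ v ha hrt =>
      simp [ScanEq, Config.setProc, afterRead, hpc, scanFrom, hφ, Fin.lt_def]
    | _ => simp_all [writeTarget, Pc.IsLocal]
  | test =>
    cases hs with
    | localStep hl =>
      rcases afterTest_cases j (c.proc j) with ⟨y, -, -, -, e⟩ | ⟨-, -, e⟩ | ⟨-, e⟩ <;>
      simp [ScanEq, Config.setProc, afterLocal, hpc, e]
    | _ => simp_all [readTarget, writeTarget]
  | crit =>
    cases hs with
    | localStep hl => simp [ScanEq, Config.setProc, afterLocal, hpc]
    | _ => simp_all [readTarget, writeTarget]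
  | awRead r =>
    cases hs with
    | invokeRead ρ hr hrt hq => simp [ScanEq, Config.setProc, hpc]
    | invokeReadDisturbed ρ hr hrt hq => simp [ScanEq, Config.setProc, hpc]
    | respondRead ρ ha hrt => cases r <;> simp [ScanEq, Config.setProc, afterRead, hpc]
    | respondReadDisturbed ρ v ha hrt => cases r <;> simp [ScanEq, Config.setProc, afterRead, hpc]
    | _ => simp_all [writeTarget, Pc.IsLocal]
  | awTest =>
    cases hs with
    | localStep hl =>
      simp only [ScanEq, Config.setProc, afterLocal, hpc, Function.update_self]
      split_ifs <;> simp
    | _ => simp_all [readTarget, writeTarget]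
  | awWrite r =>
    cases hs with
    | invokeWrite ρ hr hwt => simp [ScanEq, Config.setProc, hpc]
    | respondWrite ρ hr hwt => cases r <;> simp [ScanEq, afterWrite, hpc]
    | _ => simp_all [readTarget, Pc.IsLocal]

theorem ScanEq.step {j k : Fin n} {v : Fin K} {c c' : Config n φ K} (hφ : 0 < φ)
    (h : ScanEq j v c) (hs : Step k c c') (hw : NotWriting (prev j) c)
    (hreg : ∀ r, c.reg (prev j, r) = v) : ScanEq j v c' := by
  by_cases hjk : j = k
  · subst hjk; exact h.own hφ hs hw hreg
  · rcases hs.proc_other hjk with hp | ⟨r, hrt, -, hpk, -, -, hp⟩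
    · simpa only [ScanEq, hp] using h
    · cases hpc : (c.proc j).pc with
      | scan m r' =>
        simp only [hpc, readTarget, Option.some.injEq, Prod.mk.injEq] at hrt
        rw [← hrt.1] at hpk
        exact absurd hpk (hw r)
      | readOwn => simp [ScanEq, hp, hpc]
      | awRead r => simp [ScanEq, hp, hpc]
      | _ => simp [hpc, readTarget] at hrt

section

variable {c : ℕ → Config n φ K}

theorem reg_of_not_pend {i : Fin n} {d : Config n φ K} (hc : Clean i d) (hw : NotWriting i d)
    (hp : ¬ Pend i d) (r : Side) : d.reg (i, r) = newest i d := by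
  have hp : newest i d = eff i d := not_not.1 hp
  cases hpc : (d.proc i).pc with
  | awWrite r => exact absurd hpc (hw r)
  | awRead r' => cases r' <;> cases r <;> simp_all [Clean, eff]
  | _ => cases r <;> simp_all [Clean, eff]

/-- Without firings the pending values are used up, writing stops and the registers freeze, so every
later scan returns the predecessor's value. That no test succeeds then forces equality along `p_0,
…, p_{n-1}` and inequality between `p_{n-1}` and `p_0`. -/
theorem CleanRun.frequently_fire (hr : CleanRun c) (hc : IsExecution c) (hφ : 0 < φ)
    (hn : 0 < n) : ∃ᶠ t in atTop, ∃ i, FireAt c i t := by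
  intro hno
  obtain ⟨T, hT⟩ := eventually_atTop.1 hno
  replace hT : ∀ t ≥ T, ∀ i, ¬ FireAt c i t := fun t ht i h => hT t ht ⟨i, h⟩
  have hquiet : ∀ i, ∀ᶠ t in atTop, ¬ Pend i (c t) ∧ NotWriting i (c t) := by
    intro i
    obtain ⟨t₀, ht₀, h0⟩ := hc.exists_readOwn i T
    refine eventually_atTop.2 ⟨t₀, fun t ht => ?_⟩
    induction t, ht using Nat.le_induction with
    | base => exact ⟨not_pend_of_pc (.inl h0), fun r => by simp [h0]⟩
    | succ t ht ih =>
      obtain ⟨k, hk⟩ := hr.step t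
      have h1 : ¬ Pend i (c (t + 1)) := fun h =>
        ih.1 (hr.pend_of_succ (hT t (ht₀.trans ht) i) h)
      exact ⟨h1, ih.2.step hk (hr.clean _ i) h1⟩
  obtain ⟨S, hS⟩ := eventually_atTop.1 ((eventually_all.2 hquiet).and (eventually_ge_atTop T))
  have hTS : T ≤ S := (hS S le_rfl).2
  have hnew : ∀ i, ∀ t ≥ S, newest i (c t) = newest i (c S) := by
    intro i t ht
    induction t, ht using Nat.le_induction with
    | base => rfl
    | succ t ht ih => rw [(hr.newest_eff (hT t (hTS.trans ht) i)).1, ih]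
  have hreg : ∀ i, ∀ t ≥ S, ∀ r, (c t).reg (i, r) = newest i (c S) := fun i t ht r => by
    rw [← hnew i t ht]
    exact reg_of_not_pend (hr.clean t i) ((hS t ht).1 i).2 ((hS t ht).1 i).1 r
  have hlink : ∀ j : Fin n, (j.val ≠ 0 → newest (prev j) (c S) = newest j (c S)) ∧
      (j.val = 0 → newest (prev j) (c S) ≠ newest j (c S)) := by
    intro j
    obtain ⟨t₀, ht₀, h0⟩ := hc.exists_readOwn j S
    have hscan : ∀ t ≥ t₀, ScanEq j (newest (prev j) (c S)) (c t) := by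
      intro t ht
      induction t, ht using Nat.le_induction with
      | base => simp [ScanEq, h0]
      | succ t ht ih =>
        obtain ⟨k, hk⟩ := hr.step t
        exact ih.step hφ hk ((hS t (ht₀.trans ht)).1 _).2 (hreg _ t (ht₀.trans ht))
    obtain ⟨t, ht, hst, h1, h2⟩ := hc.exists_crossing j (θ := 6) (by omega) t₀
      (by rw [h0]; simp only [Pc.toGo]; omega)
    obtain ⟨h3, h4⟩ := hst.test_of_toGo h1 h2
    have h5 := hscan t ht
    have h6 := hr.clean t j
    have h7 := hreg j t (ht₀.trans ht) .a
    simp only [ScanEq, h3] at h5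
    simp only [Clean, h3] at h6
    rw [← h7, ← h6.1]
    have hnf := hT t ((hTS.trans ht₀).trans ht) j
    rcases afterTest_cases j ((c t).proc j) with ⟨y, -, -, -, e⟩ | ⟨-, -, e⟩ | ⟨h8, -⟩
    · exact absurd ⟨h3, by rw [h4, e]⟩ hnf
    · exact absurd ⟨h3, by rw [h4, e]⟩ hnf
    · exact h8 _ h5
  have hall : ∀ m (hm : m < n), newest ⟨m, hm⟩ (c S) = newest ⟨0, hn⟩ (c S) := by
    intro m
    induction m with
    | zero => intro _; rfl
    | succ m ih =>
      intro hm
      have h1 := (hlink ⟨m + 1, hm⟩).1 (Nat.succ_ne_zero m)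
      have h2 : prev (⟨m + 1, hm⟩ : Fin n) = ⟨m, by omega⟩ := by
        apply Fin.ext
        rw [prev_val (a := m) (by simp [Nat.mod_eq_of_lt hm]), Nat.mod_eq_of_lt (by omega)]
      rw [← h1, h2, ih]
  exact (hlink ⟨0, hn⟩).2 rfl (hall _ _)

/-- Every processor fires infinitely often. -/
theorem CleanRun.exists_fire_ge (hr : CleanRun c) (hc : IsExecution c) (hK : 1 < K) (hφ : 2 ≤ φ)
    (j : Fin n) (T : ℕ) : ∃ t ≥ T, FireAt c j t := by
  obtain ⟨i, hi⟩ : ∃ i, ∃ᶠ t in atTop, FireAt c i t := by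
    by_contra! h
    have := eventually_all.2 h
    exact hr.frequently_fire hc (by omega) j.pos (this.mono fun t ht ⟨i, h⟩ => ht i h)
  have hun : ∀ B, ∃ t, B ≤ issued c i t := by
    intro B
    induction B with
    | zero => exact ⟨0, Nat.zero_le _⟩
    | succ B ih =>
      obtain ⟨t, ht⟩ := ih
      obtain ⟨u, hu, hf⟩ := frequently_atTop.1 hi t
      have := hr.issued_mono hK i hu
      exact ⟨u + 1, by rw [(hr.issued_succ_of_fire hK hf).1]; omega⟩
  -- `p_i` is reached from `p_j` by `i + n - j` links, where `n` is added to avoid truncated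
  -- subtraction; each link loses at most 2.
  obtain ⟨t, ht⟩ := hun (issued c j T + 2 * (i.val + n - j.val) + 1)
  have h1 := hr.issued_le_add hK hφ j t (i.val + n - j.val) i (by
    rw [show j.val + (i.val + n - j.val) = i.val + n by omega, Nat.add_mod_right,
      Nat.mod_eq_of_lt i.isLt])
  have h2 : T ≤ t := by
    by_contra hlt
    have := hr.issued_mono hK j (Nat.le_of_not_le hlt)
    omega
  obtain ⟨u, hu, -, -, hf⟩ := hr.exists_fire hK h2 le_rfl (show issued c j T < issued c j t by omega)
  exact ⟨u, hu, hf⟩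

end

/-! ### Splicing executions, and the legitimate configurations -/

section

variable {c d : ℕ → Config n φ K}

theorem commits_congr {i : Fin n} {t : ℕ} (h : ∀ u ≤ t, c u = d u) :
    commits c i t = commits d i t := by
  induction t with
  | zero => rfl
  | succ t ih =>
    rw [commits, commits, ih fun u hu => h u (by omega), h t (by omega), h (t + 1) le_rfl]

theorem issued_congr {i : Fin n} {t : ℕ} (h : ∀ u ≤ t, c u = d u) :
    issued c i t = issued d i t := by
  rw [issued, issued, commits_congr h, h t le_rfl]

/-- Follow `c` up to time `T` and continue with `d`. -/
def splice (c d : ℕ → Config n φ K) (T : ℕ) : ℕ → Config n φ K :=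
  fun t => if t ≤ T then c t else d (t - (T + 1))

theorem splice_of_le {T t : ℕ} (h : t ≤ T) : splice c d T t = c t := if_pos h

theorem tailFrom_splice (c d : ℕ → Config n φ K) (T : ℕ) : tailFrom (splice c d T) (T + 1) = d := by
  funext t
  rw [tailFrom, splice, if_neg (by omega), Nat.add_sub_cancel_left]

theorem splice_add (c d : ℕ → Config n φ K) (T t : ℕ) : splice c d T (T + 1 + t) = d t :=
  congrFun (tailFrom_splice c d T) t

theorem IsExecution.splice {T : ℕ} (hd : IsExecution d)
    (hc : ∀ t < T, ∃ k, Step k (c t) (c (t + 1))) (hT : ∃ k, Step k (c T) (d 0)) :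
    IsExecution (splice c d T) := by
  obtain ⟨sd, hs, hfair⟩ := hd
  have h1 : ∀ t, ∃ k, t ≤ T → Step k (TokenRing.splice c d T t) (TokenRing.splice c d T (t + 1)) := by
    intro t
    rcases lt_trichotomy t T with h | rfl | h
    · obtain ⟨k, hk⟩ := hc t h
      exact ⟨k, fun _ => by rwa [splice_of_le h.le, splice_of_le h]⟩
    · obtain ⟨k, hk⟩ := hT
      exact ⟨k, fun _ => by rw [splice_of_le le_rfl]; exact (splice_add c d t 0).symm ▸ hk⟩
    · exact ⟨sd 0, fun h' => absurd h (by omega)⟩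
  choose sc hsc using h1
  refine ⟨fun t => if t ≤ T then sc t else sd (t - (T + 1)), fun t => ?_, fun i t => ?_⟩
  · by_cases h : t ≤ T
    · simpa only [if_pos h] using hsc t h
    · obtain ⟨u, rfl⟩ := Nat.exists_eq_add_of_lt (Nat.lt_of_not_le h)
      have h2 := hs u
      rw [← splice_add c d T u, ← splice_add c d T (u + 1)] at h2
      simp only [if_neg h]
      rw [show T + u + 1 - (T + 1) = u by omega]
      rwa [show T + u + 1 = T + 1 + u by omega]
  · obtain ⟨u, hu, hi⟩ := hfair i t
    refine ⟨T + 1 + u, by omega, ?_⟩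
    simp only
    rw [if_neg (by omega), Nat.add_sub_cancel_left, hi]

theorem IsExecution.tail (hc : IsExecution c) (s : ℕ) : IsExecution (tailFrom c s) := by
  obtain ⟨sched, hs, hfair⟩ := hc
  refine ⟨fun t => sched (s + t), fun t => hs (s + t), fun i t => ?_⟩
  obtain ⟨u, hu, hi⟩ := hfair i (s + t)
  exact ⟨u - s, by omega, by simpa only [Nat.add_sub_of_le (show s ≤ u by omega)] using hi⟩

theorem MutualExclusion.tail (h : MutualExclusion c) (s : ℕ) : MutualExclusion (tailFrom c s) := by
  refine ⟨fun t => h.1 (s + t), fun i t => ?_, fun a b i j hab hi hi' hj hno => ?_⟩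
  · obtain ⟨u, hu, hi⟩ := h.2.1 i (s + t)
    exact ⟨u - s, by omega, by rwa [tailFrom, Nat.add_sub_of_le (by omega)]⟩
  · refine h.2.2 (s + a) (s + b) i j (by omega) hi hi' hj fun u h1 h2 k => ?_
    have := hno (u - s) (by omega) (by omega) k
    rwa [tailFrom, Nat.add_sub_of_le (by omega)] at this

/-- After `p_0` has chosen `2 n + 1` values, mutual exclusion holds. -/
theorem CleanRun.mutualExclusion (hr : CleanRun c) (hc : IsExecution c) (hφ : 2 * n < φ)
    (hK : 2 * n < K) {z : Fin n} (hz : z.val = 0) {T : ℕ} (hf : FireAt c z T)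
    (hm : 2 * n < issued c z T) : MutualExclusion (tailFrom c (T + 1)) := by
  have hn := z.pos
  have hK1 : 1 < K := by omega
  obtain ⟨κ, hκ⟩ := hr.exists_isSource hK1 hφ hn
  obtain ⟨k, hS⟩ := hr.exists_synced hK hκ hz hf hm
  refine hS.mutualExclusion hκ hr hK1 (fun i t => ?_) (Nat.le_succ T)
  obtain ⟨u, hu, hfu⟩ := hr.exists_fire_ge hc hK1 (by omega) i t
  exact ⟨u + 1, by omega, hfu.2⟩

theorem IsExecution.cleanRun (hc : IsExecution c) (hK : 1 < K) (h0 : ∀ i, Clean i (c 0)) :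
    CleanRun c := by
  obtain ⟨sched, hs, -⟩ := hc
  refine ⟨fun t => ⟨_, hs t⟩, fun t i => ?_⟩
  induction t with
  | zero => exact h0 i
  | succ t ih => exact ih.step hK (hs t)

end

end TokenRing

theorem mainTheorem1 (n φ K : ℕ) (hn : 0 < n) (hφ : 2 * n < φ) (hK : 2 * n < K) :
    TokenRing.SelfStabilizing n φ K := by
  open TokenRing in
  have hK1 : 1 < K := by omega
  -- The legitimate configurations are those from which every execution meets the specification.
  refine ⟨{c | ∀ e : ℕ → Config n φ K, IsExecution e → e 0 = c → MutualExclusion e}, ?_,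
    fun c hc h => h c hc rfl, fun c hc => ?_⟩
  · intro i c c' hL hstep e he h0
    have hsp : IsExecution (splice (fun _ => c) e 0) :=
      he.splice (fun t ht => absurd ht (Nat.not_lt_zero t)) ⟨i, by rwa [h0]⟩
    rw [← tailFrom_splice (fun _ => c) e 0]
    exact (hL _ hsp rfl).tail 1
  · obtain ⟨s, hs⟩ := hc.eventually_clean hK1
    have hc' := hc.tail s
    have hr' : CleanRun (tailFrom c s) := hc'.cleanRun hK1 fun i => hs s le_rfl i
    let z : Fin n := ⟨0, hn⟩
    have hun : ∀ B, ∃ T, FireAt (tailFrom c s) z T ∧ B ≤ issued (tailFrom c s) z T := by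
      intro B
      induction B with
      | zero =>
        obtain ⟨T, -, hf⟩ := hr'.exists_fire_ge hc' hK1 (by omega) z 0
        exact ⟨T, hf, Nat.zero_le _⟩
      | succ B ih =>
        obtain ⟨T, hf, hB⟩ := ih
        obtain ⟨U, hU, hf'⟩ := hr'.exists_fire_ge hc' hK1 (by omega) z (T + 1)
        have h1 := hr'.issued_mono hK1 z hU
        rw [(hr'.issued_succ_of_fire hK1 hf).1] at h1
        exact ⟨U, hf', by omega⟩
    obtain ⟨T, hf, hB⟩ := hun (2 * n + 1)
    -- The synchronization argument needs the history of the run, which a configuration does not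
    -- record. An arbitrary execution `d` from the configuration reached is therefore appended to
    -- the actual history; all that matters up to `T` is unchanged.
    refine ⟨s + (T + 1), fun d hd h0 => ?_⟩
    have h0' : d 0 = tailFrom c s (T + 1) := h0
    have hle : ∀ u ≤ T, splice (tailFrom c s) d T u = tailFrom c s u := fun u hu => splice_of_le hu
    have he : IsExecution (splice (tailFrom c s) d T) :=
      hd.splice (fun t _ => hr'.step t) (by rw [h0']; exact hr'.step T)
    have hre : CleanRun (splice (tailFrom c s) d T) :=
      he.cleanRun hK1 fun i => by rw [hle 0 (Nat.zero_le T)]; exact hr'.clean 0 i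
    have hfe : FireAt (splice (tailFrom c s) d T) z T := by
      have h1 : splice (tailFrom c s) d T (T + 1) = tailFrom c s (T + 1) :=
        (splice_add _ d T 0).trans h0'
      rw [FireAt, hle T le_rfl, h1]
      exact hf
    rw [← tailFrom_splice (tailFrom c s) d T]
    exact hre.mutualExclusion he hφ hK rfl hfe (by rw [issued_congr hle]; exact hB)
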